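/- **Conventions.** Let $R$ be a commutative ring with $1$. A sheaf $F$ on a poset $P$ is a contravariant functor from $P$ (viewed as a category) to $R$-modules, with structure maps $F_x^y\colon F(y)\to F(x)$ for $x\le y$; it restricts to every subposet of $P$. For a finite poset $P$, $H_i(P;F)$ is the value at $F$ of the $i$-th left derived functor of the functor $\varinjlim^P$ from sheaves on $P$ to $R$-modules. If $P$ has a minimum $\mathbf 0$, the reduced homology $\widetilde H_*(P\setminus\mathbf 0;F)$ is the homology of the augmented chain complex $\cdots\to S_1\to S_0\xrightarrow{\ \epsilon\ }F(\mathbf 0)$, where $S_n=\bigoplus F(x_0)$ is the sum over all chains $\sigma=(x_n\le\cdots\le x_0)$ in $P\setminus\mathbf 0$, where $d(s_\sigma)=F_{x_1}^{x_0}(s)_{d_0\sigma}+\sum_{i=1}^n(-1)^i s_{d_i\sigma}$ with $d_i\sigma$ obtained from $\sigma$ by omitting $x_i$, and where $\epsilon$ is the sum of the maps $F_{\mathbf 0}^x$; $\widetilde H_0$ is its homology at $S_0$. **Theorem (Deletion-Restriction Long Exact Sequence).** Let $L$ be a finite lattice with minimum $\mathbf 0$ that is graded (there is $rk\colon L\to\mathbb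 Z$ which is strictly increasing and satisfies $rk(y)=rk(x)+1$ whenever $y$ covers $x$) and atomic (every element is a join of atoms, the empty join being $\mathbf 0$). Let $F$ be a sheaf on $L$ and let $a\in L$ be an atom. Let $L_a$ (the deletion) be the subposet of all elements of $L$ that are joins of atoms different from $a$, including $\mathbf 0$ as the empty join, and let $L^a=\{x\in L: x\ge a\}$ (the restriction), whose minimum is $a$. Then there is a long exact sequence of $R$-modules $$\cdots\to H_i(L^a\setminus a;F)\to H_i(L_a\setminus\mathbf 0;F)\to H_i(L\setminus\mathbf 0;F)\to H_{i-1}(L^a\setminus a;F)\to H_{i-1}(L_a\setminus\mathbf 0;F)\to\cdots$$ $$\cdots\to H_1(L\setminus\mathbf 0;F)\to\widetilde H_0(L^a\setminus a;F)\to H_0(L_a\setminus\mathbf 0;F)\to H_0(L\setminus\mathbf 0;F)\to\operatorname{coker}(\epsilon_*)\to 0$$ (the terms $H_i(L^a\setminus a;F)$ occur for all $i\ge 1$), where $\epsilon_*\colon H_0(L^a\setminus a;F)=\varinjlim^{L^a\setminus a}F\to F(a)$ is the map induced, by the universal property of the colimit, by the structure maps $F_a^x\colon F(x)\to F(a)$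 for $x>a$. -/

import Mathlib

universe u v w

open CategoryTheory CategoryTheory.Limits Opposite

noncomputable section

namespace DeletionRestriction

section Sheaves

/-- A sheaf of `R`-modules on a poset `P`: a contravariant functor from `P` to `R`-modules.
For `x ≤ y` the structure map goes from `F y` to `F x`. -/
abbrev Sheaf (R : Type v) [CommRing R] (P : Type u) [PartialOrder P] :=
  Pᵒᵖ ⥤ ModuleCat.{w} R

/-- The structure map `F_x^y : F(y) ⟶ F(x)` of a sheaf, for `x ≤ y`. -/
def Sheaf.str {R : Type v} [CommRing R] {P : Type u} [PartialOrder P]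
    (F : Sheaf.{u, v, w} R P) {x y : P} (h : x ≤ y) : F.obj (op y) ⟶ F.obj (op x) :=
  F.map (homOfLE h).op

theorem Sheaf.str_refl {R : Type v} [CommRing R] {P : Type u} [PartialOrder P]
    (F : Sheaf.{u, v, w} R P) {x : P} (h : x ≤ x) : F.str h = 𝟙 _ :=
  F.map_id (op x)

theorem Sheaf.str_comp {R : Type v} [CommRing R] {P : Type u} [PartialOrder P]
    (F : Sheaf.{u, v, w} R P) {x y z : P} (h : x ≤ y) (h' : y ≤ z) :
    F.str h' ≫ F.str h = F.str (h.trans h') :=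
  (F.map_comp (homOfLE h').op (homOfLE h).op).symm

/-- The pullback `f^* F = F ∘ f` of a sheaf along a poset map; for the inclusion of a
subposet this is the restriction of `F`. -/
@[simps]
def Sheaf.pullback {R : Type v} [CommRing R] {P : Type u} [PartialOrder P]
    {Q : Type u} [PartialOrder Q] (f : Q →o P) (F : Sheaf.{u, v, w} R P) :
    Sheaf.{u, v, w} R Q where
  obj x := F.obj (op (f x.unop))
  map {_ _} h := F.str (f.monotone (leOfHom h.unop))
  map_id _ := F.str_refl _
  map_comp {_ _ _} _ _ := (F.str_comp _ _).symm

/-- Colimits over a finite poset exist in the category of `R`-modules. -/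
instance hasColimitsOfShape_op (R : Type v) [CommRing R] (P : Type u) [PartialOrder P]
    [Finite P] : HasColimitsOfShape Pᵒᵖ (ModuleCat.{w} R) := by
  have := Fintype.ofFinite P
  infer_instance

/-- The colimit functor on sheaves is additive. -/
instance colim_additive (R : Type v) [CommRing R] (P : Type u) [PartialOrder P] [Finite P] :
    (colim : Sheaf.{u, v, w} R P ⥤ ModuleCat.{w} R).Additive :=
  colimConstAdj.left_adjoint_additive

/-- The category of sheaves on a finite poset has enough projectives. -/
instance enoughProjectives (R : Type v) [CommRing R] [Small.{w} R] (P : Type u)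
    [PartialOrder P] [Finite P] : EnoughProjectives (Sheaf.{u, v, w} R P) where
  presentation F := by
    have : ∀ a b : Pᵒᵖ, Finite (a ⟶ b) := fun a b => Finite.of_subsingleton
    let G : Pᵒᵖ → Sheaf.{u, v, w} R P := fun x =>
      (evaluationLeftAdjoint (ModuleCat.{w} R) x).obj (Projective.over (F.obj x))
    have hG : ∀ x, Projective (G x) := fun x =>
      (evaluationAdjunctionRight (ModuleCat.{w} R) x).map_projective _ inferInstance
    let φ : ∀ x, G x ⟶ F := fun x =>
      ((evaluationAdjunctionRight (ModuleCat.{w} R) x).homEquiv _ _).symm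
        (Projective.π (F.obj x))
    have : HasCoproduct G := inferInstance
    have hp : Projective (∐ G) := by
      constructor
      intro E X f e he
      refine ⟨Sigma.desc fun x => Projective.factorThru (Sigma.ι G x ≫ f) e, ?_⟩
      refine Sigma.hom_ext _ _ fun x => ?_
      rw [Sigma.ι_desc_assoc, Projective.factorThru_comp]
    refine ⟨{ p := ∐ G, f := Sigma.desc φ, projective := hp, epi := ?_ }⟩
    have key : ∀ x, Epi ((Sigma.desc φ).app x) := by
      intro x
      have h : (evaluationAdjunctionRight (ModuleCat.{w} R) x).homEquiv _ _ (φ x) =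
          Projective.π (F.obj x) := Equiv.apply_symm_apply _ _
      have h3 : ((evaluationAdjunctionRight (ModuleCat.{w} R) x).homEquiv _ _ (Sigma.ι G x)) ≫
          ((evaluation _ _).obj x).map (Sigma.desc φ) = Projective.π (F.obj x) := by
        rw [← Adjunction.homEquiv_naturality_right, Sigma.ι_desc, h]
      have h4 : Epi (((evaluationAdjunctionRight (ModuleCat.{w} R) x).homEquiv _ _
          (Sigma.ι G x)) ≫ ((evaluation _ _).obj x).map (Sigma.desc φ)) := by
        rw [h3]; exact Projective.π_epi (F.obj x)
      exact epi_of_epi ((evaluationAdjunctionRight (ModuleCat.{w} R) x).homEquiv _ _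
          (Sigma.ι G x)) (((evaluation _ _).obj x).map (Sigma.desc φ))
    exact NatTrans.epi_of_epi_app _

/-- The homology `H_n(P; F)` of a finite poset `P` with coefficients in the sheaf `F`:
the value at `F` of the `n`-th higher colimit, that is, of the `n`-th left derived functor
of the colimit functor on sheaves. -/
def homology {R : Type v} [CommRing R] [Small.{w} R] {P : Type u} [PartialOrder P] [Finite P]
    (F : Sheaf.{u, v, w} R P) (n : ℕ) : ModuleCat.{w} R :=
  ((colim : Sheaf.{u, v, w} R P ⥤ ModuleCat.{w} R).leftDerived n).obj F

end Sheaves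

section ChainComplex

/-- The `n`-simplices `x_n ≤ ⋯ ≤ x_0` of the order complex of `P`. -/
@[ext]
structure Simplex (P : Type u) [PartialOrder P] (n : ℕ) where
  /-- The vertex `x_i`. -/
  vertex : Fin (n + 1) → P
  antitone : Antitone vertex

instance (P : Type u) [PartialOrder P] [Finite P] (n : ℕ) : Finite (Simplex P n) :=
  Finite.of_injective Simplex.vertex fun _ _ => Simplex.ext

theorem Simplex.le_zero {P : Type u} [PartialOrder P] {n : ℕ} (σ : Simplex P n)
    (i : Fin (n + 1)) : σ.vertex i ≤ σ.vertex 0 :=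
  σ.antitone (Fin.zero_le i)

/-- The simplex `σ ∘ g`; for `g` the `i`-th coface map this is `d_i σ`, that is, `σ` with
`x_i` omitted. -/
@[simps]
def Simplex.comp {P : Type u} [PartialOrder P] {m n : ℕ} (σ : Simplex P n)
    (g : Fin (m + 1) →o Fin (n + 1)) : Simplex P m where
  vertex := σ.vertex ∘ g
  antitone := σ.antitone.comp_monotone g.monotone

theorem Simplex.comp_zero_le {P : Type u} [PartialOrder P] {m n : ℕ} (σ : Simplex P n)
    (g : Fin (m + 1) →o Fin (n + 1)) : (σ.comp g).vertex 0 ≤ σ.vertex 0 :=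
  σ.le_zero (g 0)

variable {R : Type v} [CommRing R] {P : Type u} [PartialOrder P] [Finite P]

/-- The module `⨁_σ F(x_0)`, the sum being over all `n`-simplices
`σ = (x_n ≤ ⋯ ≤ x_0)` of the order complex. -/
def chainModule (F : Sheaf.{u, v, w} R P) (n : ℕ) : ModuleCat.{w} R :=
  ∐ fun σ : Simplex P n => F.obj (op (σ.vertex 0))

/-- The inclusion `s ↦ s_σ` of the summand of `σ`. -/
def chainModule.ι (F : Sheaf.{u, v, w} R P) {n : ℕ} (σ : Simplex P n) :
    F.obj (op (σ.vertex 0)) ⟶ chainModule F n :=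
  Sigma.ι (fun σ : Simplex P n => F.obj (op (σ.vertex 0))) σ

/-- The map out of `⨁_σ F(x_0)` with the given components. -/
def chainModule.desc (F : Sheaf.{u, v, w} R P) {n : ℕ} {M : ModuleCat.{w} R}
    (φ : ∀ σ : Simplex P n, F.obj (op (σ.vertex 0)) ⟶ M) : chainModule F n ⟶ M :=
  Sigma.desc φ

theorem chainModule.hom_ext (F : Sheaf.{u, v, w} R P) {n : ℕ} {M : ModuleCat.{w} R}
    {φ ψ : chainModule F n ⟶ M} (h : ∀ σ, chainModule.ι F σ ≫ φ = chainModule.ι F σ ≫ ψ) :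
    φ = ψ :=
  Sigma.hom_ext _ _ h

@[simp]
theorem chainModule.ι_desc (F : Sheaf.{u, v, w} R P) {n : ℕ} {M : ModuleCat.{w} R}
    (φ : ∀ σ : Simplex P n, F.obj (op (σ.vertex 0)) ⟶ M) (σ : Simplex P n) :
    chainModule.ι F σ ≫ chainModule.desc F φ = φ σ :=
  Sigma.ι_desc _ _

theorem chainModule.ι_desc_assoc (F : Sheaf.{u, v, w} R P) {n : ℕ} {M N : ModuleCat.{w} R}
    (φ : ∀ σ : Simplex P n, F.obj (op (σ.vertex 0)) ⟶ M) (σ : Simplex P n) (h : M ⟶ N) :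
    chainModule.ι F σ ≫ chainModule.desc F φ ≫ h = φ σ ≫ h :=
  Sigma.ι_desc_assoc _ _ _

/-- The simplicial operator `⨁_σ F(x_0) ⟶ ⨁_τ F(y_0)` of a monotone map `g`: it sends the
summand of `σ` to that of `σ ∘ g` by the structure map `F(x_0) ⟶ F(x_{g 0})`. -/
def chainModule.map (F : Sheaf.{u, v, w} R P) {m n : ℕ} (g : Fin (m + 1) →o Fin (n + 1)) :
    chainModule F n ⟶ chainModule F m :=
  chainModule.desc F fun σ =>
    F.str (σ.comp_zero_le g) ≫ chainModule.ι F (σ.comp g)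

theorem chainModule.map_id (F : Sheaf.{u, v, w} R P) (n : ℕ) :
    chainModule.map F (OrderHom.id : Fin (n + 1) →o Fin (n + 1)) = 𝟙 _ := by
  refine chainModule.hom_ext F fun σ => ?_
  rw [chainModule.map, chainModule.ι_desc, Category.comp_id]
  exact (congrArg (· ≫ chainModule.ι F σ) (F.str_refl le_rfl)).trans (Category.id_comp _)

theorem chainModule.map_comp (F : Sheaf.{u, v, w} R P) {k m n : ℕ}
    (g : Fin (m + 1) →o Fin (n + 1)) (h : Fin (k + 1) →o Fin (m + 1)) :
    chainModule.map F (g.comp h) = chainModule.map F g ≫ chainModule.map F h := by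
  refine chainModule.hom_ext F fun σ => ?_
  have h1 : chainModule.ι F σ ≫ chainModule.map F g ≫ chainModule.map F h =
      F.str (((σ.comp g).comp_zero_le h).trans (σ.comp_zero_le g)) ≫
        chainModule.ι F ((σ.comp g).comp h) := by
    rw [chainModule.map, chainModule.map, chainModule.ι_desc_assoc, Category.assoc,
      chainModule.ι_desc, ← Category.assoc, Sheaf.str_comp]
  rw [h1, chainModule.map, chainModule.ι_desc]
  rfl

/-- The simplicial module with `n`-th term `⨁_σ F(x_0)`. -/
@[simps]
def simplicialModule (F : Sheaf.{u, v, w} R P) : SimplicialObject (ModuleCat.{w} R) where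
  obj n := chainModule F n.unop.len
  map {_ _} g := chainModule.map F g.unop.toOrderHom
  map_id n := chainModule.map_id F n.unop.len
  map_comp {_ _ _} g h := chainModule.map_comp F g.unop.toOrderHom h.unop.toOrderHom

/-- The chain complex `S_*(P; F)`, with `S_n(P; F) = ⨁_σ F(x_0)` and with differential the
alternating sum of the face maps: the `0`-th face is
`s_σ ↦ (F(x_0) → F(x_1))(s)_{d_0 σ}` and the `i`-th one, for `i > 0`, is `s_σ ↦ s_{d_i σ}`. -/
def chains (F : Sheaf.{u, v, w} R P) : ChainComplex (ModuleCat.{w} R) ℕ :=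
  (AlgebraicTopology.alternatingFaceMapComplex (ModuleCat.{w} R)).obj (simplicialModule F)

end ChainComplex

section Punctured

/-- The poset `P ∖ 0`, for a poset `P` with minimum `0`. -/
abbrev Punctured (P : Type u) [PartialOrder P] [OrderBot P] := {x : P // x ≠ ⊥}

variable {R : Type v} [CommRing R] {P : Type u} [PartialOrder P] [OrderBot P]

/-- The restriction of a sheaf on `P` to `P ∖ 0`. -/
abbrev Sheaf.punctured (F : Sheaf.{u, v, w} R P) : Sheaf.{u, v, w} R (Punctured P) :=
  F.pullback (OrderHom.Subtype.val fun x : P => x ≠ ⊥)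

/-- The structure map `F_0^x : F(x) ⟶ F(0)`, for `x` in `P ∖ 0`. -/
def Sheaf.toBot (F : Sheaf.{u, v, w} R P) (x : Punctured P) :
    F.punctured.obj (op x) ⟶ F.obj (op ⊥) :=
  F.str (bot_le : ⊥ ≤ x.1)

theorem Sheaf.str_toBot (F : Sheaf.{u, v, w} R P) {x y : Punctured P} (h : x ≤ y) :
    F.punctured.str h ≫ F.toBot x = F.toBot y :=
  F.str_comp (bot_le : ⊥ ≤ x.1) h

variable [Finite P]

/-- The map `ε_* : colim_{P ∖ 0} F ⟶ F(0)` given, by the universal property of the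
colimit, by the structure maps `F(x) ⟶ F(0)`. -/
def epsilonStar (F : Sheaf.{u, v, w} R P) : colimit F.punctured ⟶ F.obj (op ⊥) :=
  colimit.desc F.punctured
    { pt := F.obj (op ⊥)
      ι :=
        { app := fun x => F.toBot x.unop
          naturality := fun _ _ f =>
            (F.str_toBot (leOfHom f.unop)).trans (Category.comp_id _).symm } }

/-- The augmentation `ε : S_0(P ∖ 0; F) ⟶ F(0)`: the sum of the structure maps
`F(x) ⟶ F(0)`. -/
def augmentation (F : Sheaf.{u, v, w} R P) : chainModule F.punctured 0 ⟶ F.obj (op ⊥) :=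
  chainModule.desc F.punctured fun σ => F.toBot (σ.vertex 0)

theorem map_comp_augmentation (F : Sheaf.{u, v, w} R P) {n : ℕ}
    (g : Fin (0 + 1) →o Fin (n + 1)) :
    chainModule.map F.punctured g ≫ augmentation F =
      chainModule.desc F.punctured fun σ => F.toBot (σ.vertex 0) := by
  refine chainModule.hom_ext _ fun σ => ?_
  rw [chainModule.map, augmentation, chainModule.ι_desc_assoc, Category.assoc,
    chainModule.ι_desc, chainModule.ι_desc, Sheaf.str_toBot]

theorem d_comp_augmentation (F : Sheaf.{u, v, w} R P) :
    (chains F.punctured).d 1 0 ≫ (augmentation F : (chains F.punctured).X 0 ⟶ _) = 0 := by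
  let g : Fin 2 → (Fin (0 + 1) →o Fin (1 + 1)) := fun i =>
    (SimplexCategory.δ (n := 0) i).toOrderHom
  have hd : (chains F.punctured).d 1 0 =
      (chainModule.map F.punctured (g 0) - chainModule.map F.punctured (g 1) :
        chainModule F.punctured 1 ⟶ chainModule F.punctured 0) := by
    refine (AlgebraicTopology.AlternatingFaceMapComplex.obj_d_eq _ 0).trans ?_
    rw [Fin.sum_univ_two, sub_eq_add_neg]
    congr 1
    · exact one_smul ℤ _
    · exact (congrArg (· • _) (pow_one (-1 : ℤ))).trans (neg_one_smul ℤ _)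
  have key : (chainModule.map F.punctured (g 0) - chainModule.map F.punctured (g 1)) ≫
      augmentation F = 0 := by
    rw [Preadditive.sub_comp, map_comp_augmentation, map_comp_augmentation, sub_self]
  exact (congrArg (· ≫ augmentation F) hd).trans key

/-- The augmented chain complex `⋯ ⟶ S_1(P ∖ 0; F) ⟶ S_0(P ∖ 0; F) ⟶ F(0)`, reindexed so that
`F(0)` sits in degree `0` and `S_n(P ∖ 0; F)` in degree `n + 1`. -/
def augmentedChains (F : Sheaf.{u, v, w} R P) : ChainComplex (ModuleCat.{w} R) ℕ :=
  (chains F.punctured).augment (augmentation F) (d_comp_augmentation F)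

/-- The reduced homology `H̃_n(P ∖ 0; F)`, for `n ≥ 0`: the homology of the augmented chain
complex at `S_n(P ∖ 0; F)`. -/
def reducedHomology (F : Sheaf.{u, v, w} R P) (n : ℕ) : ModuleCat.{w} R :=
  (augmentedChains F).homology (n + 1)

end Punctured

section Lattice

variable {L : Type u} [Lattice L] [OrderBot L]

/-- The deletion `L_a`: the elements of `L` that are joins of atoms different from `a`
(the empty join being `0`). -/
abbrev Deletion (a : L) : Type u :=
  {x : L // ∃ s : Set L, (∀ b ∈ s, IsAtom b ∧ b ≠ a) ∧ IsLUB s x}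

/-- The minimum of `L_a` is the minimum of `L`. -/
instance (a : L) : OrderBot (Deletion a) where
  bot := ⟨⊥, ∅, by simp, by simp⟩
  bot_le x := (bot_le : ⊥ ≤ x.1)

/-- The inclusion of the deletion `L_a` in `L`. -/
def Deletion.incl (a : L) : Deletion a →o L :=
  OrderHom.Subtype.val fun x => ∃ s : Set L, (∀ b ∈ s, IsAtom b ∧ b ≠ a) ∧ IsLUB s x

/-- The restriction `L^a`: the interval of all elements `≥ a`; its minimum is `a`. -/
abbrev Restriction (a : L) : Type u := Set.Ici a

/-- The inclusion of the restriction `L^a` in `L`. -/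
def Restriction.incl (a : L) : Restriction a →o L := OrderHom.Subtype.val fun x => x ∈ Set.Ici a

variable {R : Type v} [CommRing R]

/-- The restriction of a sheaf on `L` to the deletion `L_a`. -/
abbrev Sheaf.deletion (F : Sheaf.{u, v, w} R L) (a : L) : Sheaf.{u, v, w} R (Deletion a) :=
  F.pullback (Deletion.incl a)

/-- The restriction of a sheaf on `L` to the restriction lattice `L^a`. -/
abbrev Sheaf.restriction (F : Sheaf.{u, v, w} R L) (a : L) :
    Sheaf.{u, v, w} R (Restriction a) :=
  F.pullback (Restriction.incl a)

end Lattice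

end DeletionRestriction

end

/-! Put `P = L ∖ 0`, in which `a` is minimal, and let `i` and `j` be the inclusions of `L_a ∖ 0` and
`L^a ∖ a` in `P`. The sequence comes from comparing additive functors on sheaves on `P`. Let `K(F)`
be the cokernel of `colim j^* F ⟶ F(a)`. For projective `F` there are two short exact sequences with
the same last term: `0 ⟶ colim j^* F ⟶ F(a) ⟶ K(F) ⟶ 0` and `0 ⟶ colim i^* F ⟶ colim F ⟶ K(F) ⟶ 0`.
Evaluation at `a` is exact, so the first identifies `L_{n+1} K` with `L_n (colim j^*)` for `n ≥ 1`,
while `L_1 K` and `L_0 K` are the kernel and cokernel of `colim j^* F ⟶ F(a)`, that is, `H̃_0(L^a ∖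
a; F)` and `coker ε_*`. Substituting this in the long exact sequence of the second gives the theorem
(`exists_leftDerived_exact_of_common_cokernel`).

The combinatorial input is that `i` and `j` have right adjoints on the upper sets `{x ≠ a}` and `{x
> a}` of `P`. For `j` the adjoint is the identity. For `i` it sends `x` to the join of the atoms `≠
a` below `x`, which is not `0` because `L` is atomic and `x ≠ 0, a`. Such a partial adjoint makes
the right Kan extension exact, so pullback preserves projectives and the derived functors of `colim
f^*` are the homology of `f^* F` (`PartialRightAdjoint.homologyIso`). It also provides retractions
showing that the left-hand maps above are injective on projectives
(`PartialRightAdjoint.exists_extension`). -/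

noncomputable section

namespace DeletionRestriction

/-! ### Left derived functors and their long exact sequences -/

section LeftDerived

universe u₁ v₁ u₂ v₂

variable {C : Type u₁} [Category.{v₁} C] [Abelian C] [HasProjectiveResolutions C]
  {D : Type u₂} [Category.{v₂} D] [Abelian D]

/-- The higher left derived functors of an exact functor vanish. -/
theorem isZero_leftDerived_of_preservesHomology (T : C ⥤ D) [T.Additive] [T.PreservesHomology]
    (X : C) (n : ℕ) : IsZero ((T.leftDerived (n + 1)).obj X) := by
  let P := projectiveResolution X
  refine IsZero.of_iso ?_ (P.isoLeftDerivedObj T (n + 1))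
  refine (HomologicalComplex.exactAt_iff_isZero_homology _ _).1 ?_
  rw [HomologicalComplex.exactAt_iff' _ (n + 2) (n + 1) n (by simp) (by simp)]
  exact (P.exact_succ n).map T

/-- The left derived functors of `G ⋙ T`, for `G` exact and preserving projectives. -/
def leftDerivedCompIso {E : Type*} [Category E] [Abelian E] [HasProjectiveResolutions E]
    (G : C ⥤ E) [G.Additive] [G.PreservesProjectiveObjects] [G.PreservesHomology]
    (T : E ⥤ D) [T.Additive] (X : C) (n : ℕ) :
    ((G ⋙ T).leftDerived n).obj X ≅ (T.leftDerived n).obj (G.obj X) :=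
  (projectiveResolution X).isoLeftDerivedObj (G ⋙ T) n ≪≫
    ((G.mapProjectiveResolution (projectiveResolution X)).isoLeftDerivedObj T n).symm

variable {T₁ T₂ T₃ : C ⥤ D} [T₁.Additive] [T₂.Additive] [T₃.Additive]
  (α : T₁ ⟶ T₂) (β : T₂ ⟶ T₃) (w : α ≫ β = 0)

/-- The long exact sequence of left derived functors attached to a sequence of additive functors
which is short exact on projective objects. -/
theorem exists_leftDerived_exact
    (h : ∀ (P : C) [Projective P], (ShortComplex.mk (α.app P) (β.app P)
      (by rw [← NatTrans.comp_app, w, zero_app])).ShortExact) (X : C) :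
    ∃ (δ : ∀ n : ℕ, (T₃.leftDerived (n + 1)).obj X ⟶ (T₁.leftDerived n).obj X)
      (w₁ : ∀ n, δ n ≫ (NatTrans.leftDerived α n).app X = 0)
      (w₂ : ∀ n, (NatTrans.leftDerived α n).app X ≫ (NatTrans.leftDerived β n).app X = 0)
      (w₃ : ∀ n, (NatTrans.leftDerived β (n + 1)).app X ≫ δ n = 0),
      (∀ n, (ShortComplex.mk _ _ (w₁ n)).Exact) ∧ (∀ n, (ShortComplex.mk _ _ (w₂ n)).Exact) ∧
      (∀ n, (ShortComplex.mk _ _ (w₃ n)).Exact) ∧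
      Epi ((NatTrans.leftDerived β 0).app X) := by
  let P := projectiveResolution X
  let S : ShortComplex (ChainComplex D ℕ) := ShortComplex.mk
    ((NatTrans.mapHomologicalComplex α _).app P.complex)
    ((NatTrans.mapHomologicalComplex β _).app P.complex)
    (by ext n; exact (by rw [← NatTrans.comp_app, w, zero_app] :
      α.app (P.complex.X n) ≫ β.app (P.complex.X n) = 0))
  -- The terms of a projective resolution are projective, so the hypothesis applies in each degree.
  have hS : S.ShortExact := HomologicalComplex.shortExact_of_degreewise_shortExact _ fun n =>
    h (P.complex.X n)
  have rel : ∀ n, (ComplexShape.down ℕ).Rel (n + 1) n := fun n => rfl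
  let e₁ : ∀ n, (T₁.leftDerived n).obj X ≅ S.X₁.homology n := P.isoLeftDerivedObj T₁
  let e₂ : ∀ n, (T₂.leftDerived n).obj X ≅ S.X₂.homology n := P.isoLeftDerivedObj T₂
  let e₃ : ∀ n, (T₃.leftDerived n).obj X ≅ S.X₃.homology n := P.isoLeftDerivedObj T₃
  have hα : ∀ n, (NatTrans.leftDerived α n).app X =
      (e₁ n).hom ≫ HomologicalComplex.homologyMap S.f n ≫ (e₂ n).inv :=
    fun n => P.leftDerived_app_eq α n
  have hβ : ∀ n, (NatTrans.leftDerived β n).app X =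
      (e₂ n).hom ≫ HomologicalComplex.homologyMap S.g n ≫ (e₃ n).inv :=
    fun n => P.leftDerived_app_eq β n
  refine ⟨fun n => (e₃ (n + 1)).hom ≫ hS.δ (n + 1) n (rel n) ≫ (e₁ n).inv, fun n => ?_, fun n => ?_,
    fun n => ?_, fun n => ?_, fun n => ?_, fun n => ?_, ?_⟩
  · have := hS.δ_comp (n + 1) n (rel n)
    simp [hα, reassoc_of% this]
  · have : HomologicalComplex.homologyMap S.f n ≫ HomologicalComplex.homologyMap S.g n = 0 := by
      rw [← HomologicalComplex.homologyMap_comp, S.zero, HomologicalComplex.homologyMap_zero]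
    simp [hα, hβ, reassoc_of% this]
  · have := hS.comp_δ (n + 1) n (rel n)
    simp [hβ, reassoc_of% this]
  · refine ShortComplex.exact_of_iso (ShortComplex.isoMk (e₃ (n + 1)).symm (e₁ n).symm
      (e₂ n).symm ?_ ?_) (hS.homology_exact₁ (n + 1) n (rel n)) <;> simp [hα]
  · refine ShortComplex.exact_of_iso (ShortComplex.isoMk (e₁ n).symm (e₂ n).symm
      (e₃ n).symm ?_ ?_) (hS.homology_exact₂ n) <;> simp [hα, hβ]
  · refine ShortComplex.exact_of_iso (ShortComplex.isoMk (e₂ (n + 1)).symm (e₃ (n + 1)).symm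
      (e₁ n).symm ?_ ?_) (hS.homology_exact₃ (n + 1) n (rel n)) <;> simp [hβ]
  · have := hS.epi_g
    -- No differential leaves degree `0`, so an epimorphism of complexes remains one on `H_0`.
    have : Epi (HomologicalComplex.homologyMap S.g 0) :=
      HomologicalComplex.epi_homologyMap_of_epi_of_not_rel _ _ (by simp)
    rw [hβ]
    infer_instance


/-- The comparison `L_0 T ⟶ T` is natural in the functor `T`. -/
theorem leftDerived_zero_app_comp_fromLeftDerivedZero {T₁ T₂ : C ⥤ D} [T₁.Additive] [T₂.Additive]
    (α : T₁ ⟶ T₂) (X : C) :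
    (NatTrans.leftDerived α 0).app X ≫ T₂.fromLeftDerivedZero.app X =
      T₁.fromLeftDerivedZero.app X ≫ α.app X := by
  let P := projectiveResolution X
  let φ := (NatTrans.mapHomologicalComplex α (ComplexShape.down ℕ)).app P.complex
  -- On opcycles the comparison is induced by `T(P_0) ⟶ T(X)`, so the claim reduces to naturality of
  -- `α` at `P_0 ⟶ X`.
  have h : HomologicalComplex.opcyclesMap φ 0 ≫ P.fromLeftDerivedZero' T₂ =
      P.fromLeftDerivedZero' T₁ ≫ α.app X := by
    rw [← cancel_epi (HomologicalComplex.pOpcycles _ _), HomologicalComplex.p_opcyclesMap_assoc,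
      P.pOpcycles_comp_fromLeftDerivedZero', P.pOpcycles_comp_fromLeftDerivedZero'_assoc]
    exact (α.naturality (P.π.f 0)).symm
  let e₁ : (T₁.leftDerived 0).obj X ≅ HomologicalComplex.homology _ 0 := P.isoLeftDerivedObj T₁ 0
  let e₂ : (T₂.leftDerived 0).obj X ≅ HomologicalComplex.homology _ 0 := P.isoLeftDerivedObj T₂ 0
  have h₁ : T₁.fromLeftDerivedZero.app X = e₁.hom ≫ HomologicalComplex.homologyι _ 0 ≫
    P.fromLeftDerivedZero' T₁ := P.fromLeftDerivedZero_eq T₁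
  have h₂ : T₂.fromLeftDerivedZero.app X = e₂.hom ≫ HomologicalComplex.homologyι _ 0 ≫
    P.fromLeftDerivedZero' T₂ := P.fromLeftDerivedZero_eq T₂
  have h₃ : (NatTrans.leftDerived α 0).app X =
    e₁.hom ≫ HomologicalComplex.homologyMap φ 0 ≫ e₂.inv := P.leftDerived_app_eq α 0
  rw [h₁, h₂, h₃, Category.assoc, Category.assoc, Iso.inv_hom_id_assoc, Category.assoc,
    Category.assoc, ← h, HomologicalComplex.homologyι_naturality_assoc]

end LeftDerived

/-! ### Splicing two long exact sequences with a common term -/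

section Modules

universe u₁ v₁

theorem exact_iso_comp {R : Type v} [CommRing R] {M₁ M₂ M₃ N₁ N₂ N₃ : ModuleCat.{w} R}
    {f : M₁ ⟶ M₂} {g : M₂ ⟶ M₃} (h : Function.Exact f g) (e₁ : N₁ ≅ M₁) (e₂ : M₂ ≅ N₂)
    (e₃ : M₃ ≅ N₃) : Function.Exact (e₁.hom ≫ f ≫ e₂.hom) (e₂.inv ≫ g ≫ e₃.hom) := by
  have w : f ≫ g = 0 := by
    ext x
    exact h.apply_apply_eq_zero x
  refine (ShortComplex.ShortExact.moduleCat_exact_iff_function_exact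
    (ShortComplex.mk (e₁.hom ≫ f ≫ e₂.hom) (e₂.inv ≫ g ≫ e₃.hom) (by simp [reassoc_of% w]))).1 ?_
  refine ShortComplex.exact_of_iso (ShortComplex.isoMk e₁.symm e₂ e₃ ?_ ?_)
    ((ShortComplex.ShortExact.moduleCat_exact_iff_function_exact (ShortComplex.mk f g w)).2 h) <;>
    simp

variable {R : Type v} [CommRing R]
  {C : Type u₁} [Category.{v₁} C] [Abelian C] [HasProjectiveResolutions C]
  {T₁ T₂ T₃ E K : C ⥤ ModuleCat.{w} R} [T₁.Additive] [T₂.Additive] [T₃.Additive] [E.Additive]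
  [K.Additive] [PreservesFiniteColimits T₁] [PreservesFiniteColimits E] [E.PreservesHomology]

/-- If `0 ⟶ T₁ ⟶ E ⟶ K ⟶ 0` and `0 ⟶ T₂ ⟶ T₃ ⟶ K ⟶ 0` are short exact on projective objects and
`E` is exact, then the left derived functors of `T₁`, `T₂`, `T₃` form a long exact sequence. -/
theorem exists_leftDerived_exact_of_common_cokernel
    (α : T₁ ⟶ E) (π : E ⟶ K) (w : α ≫ π = 0) (γ : T₂ ⟶ T₃) (θ : T₃ ⟶ K) (w' : γ ≫ θ = 0)
    (h : ∀ (P : C) [Projective P], (ShortComplex.mk (α.app P) (π.app P)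
      (by rw [← NatTrans.comp_app, w, zero_app])).ShortExact)
    (h' : ∀ (P : C) [Projective P], (ShortComplex.mk (γ.app P) (θ.app P)
      (by rw [← NatTrans.comp_app, w', zero_app])).ShortExact)
    (X : C) {N : ModuleCat.{w} R} (κ : N ⟶ T₁.obj X) [Mono κ]
    (hκ : Function.Exact κ (α.app X)) :
    ∃ (f : ∀ n : ℕ, (T₁.leftDerived (n + 1)).obj X ⟶ (T₂.leftDerived (n + 1)).obj X)
      (g : ∀ n : ℕ, (T₂.leftDerived n).obj X ⟶ (T₃.leftDerived n).obj X)
      (δ : ∀ n : ℕ, (T₃.leftDerived (n + 2)).obj X ⟶ (T₁.leftDerived (n + 1)).obj X)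
      (δ₁ : (T₃.leftDerived 1).obj X ⟶ N)
      (f₀ : N ⟶ (T₂.leftDerived 0).obj X)
      (δ₀ : (T₃.leftDerived 0).obj X ⟶ cokernel (α.app X)),
      (∀ n, Function.Exact (f n) (g (n + 1))) ∧
      (∀ n, Function.Exact (g (n + 2)) (δ n)) ∧
      (∀ n, Function.Exact (δ n) (f n)) ∧
      Function.Exact (g 1) δ₁ ∧
      Function.Exact δ₁ f₀ ∧
      Function.Exact f₀ (g 0) ∧
      Function.Exact (g 0) δ₀ ∧
      Function.Surjective δ₀ := by
  obtain ⟨d, w₁, w₂, w₃, ex₁, ex₂, ex₃, hepi⟩ := exists_leftDerived_exact α π w h X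
  obtain ⟨d', w₁', w₂', w₃', ex₁', ex₂', ex₃', hepi'⟩ := exists_leftDerived_exact γ θ w' h' X
  have hE := isZero_leftDerived_of_preservesHomology E X
  -- The connecting map `L_{n+1} K ⟶ L_n T₁` lies between `L_{n+1} E = 0` and `L_n E`. It is
  -- therefore always mono, and iso as soon as `n ≥ 1`.
  have hmono : ∀ n, Mono (d n) := fun n => (ex₃ n).mono_g ((hE n).eq_of_src _ _)
  have hiso : ∀ n, IsIso (d (n + 1)) := fun n =>
    have := hmono (n + 1)
    have : Epi (d (n + 1)) := (ex₁ (n + 1)).epi_f ((hE n).eq_of_tgt _ _)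
    isIso_of_mono_of_epi _
  let eT : (T₁.leftDerived 0).obj X ≅ T₁.obj X := asIso (T₁.fromLeftDerivedZero.app X)
  let eE : (E.leftDerived 0).obj X ≅ E.obj X := asIso (E.fromLeftDerivedZero.app X)
  have hα : (NatTrans.leftDerived α 0).app X ≫ eE.hom = eT.hom ≫ α.app X :=
    leftDerived_zero_app_comp_fromLeftDerivedZero α X
  have wκ : κ ≫ α.app X = 0 := by
    ext x
    exact hκ.apply_apply_eq_zero x
  have exκ : (ShortComplex.mk κ (α.app X) wκ).Exact :=
    (ShortComplex.ShortExact.moduleCat_exact_iff_function_exact _).2 hκ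
  have wd : (d 0 ≫ eT.hom) ≫ α.app X = 0 := by
    rw [Category.assoc, ← hα, reassoc_of% w₁ 0, zero_comp]
  have exd : (ShortComplex.mk (d 0 ≫ eT.hom) (α.app X) wd).Exact :=
    ShortComplex.exact_of_iso (S₁ := .mk _ _ (w₁ 0)) (ShortComplex.isoMk (Iso.refl _) eT eE (by simp) hα.symm) (ex₁ 0)
  have : Mono (d 0) := hmono 0
  have m₁ : Mono (ShortComplex.mk κ (α.app X) wκ).f := ‹Mono κ›
  have m₂ : Mono (ShortComplex.mk (d 0 ≫ eT.hom) (α.app X) wd).f := mono_comp _ _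
  -- Both modules are kernels of `α.app X`, once `L_0 T₁` and `L_0 E` are replaced by `T₁` and `E`
  -- by right exactness.
  let eN : (K.leftDerived 1).obj X ≅ N :=
    IsLimit.conePointUniqueUpToIso exd.fIsKernel exκ.fIsKernel
  have wc : α.app X ≫ eE.inv ≫ (NatTrans.leftDerived π 0).app X = 0 := by
    rw [← cancel_epi eT.hom, ← reassoc_of% hα, Iso.hom_inv_id_assoc, w₂ 0, comp_zero]
  have exc : (ShortComplex.mk (α.app X) (eE.inv ≫ (NatTrans.leftDerived π 0).app X) wc).Exact :=
    ShortComplex.exact_of_iso (S₁ := .mk _ _ (w₂ 0)) (ShortComplex.isoMk eT eE (Iso.refl _) hα.symm (by simp)) (ex₂ 0)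
  have e₁ : Epi (ShortComplex.mk (α.app X) (eE.inv ≫ (NatTrans.leftDerived π 0).app X) wc).g :=
    epi_comp _ _
  -- Here `L_0 K` is found as a cokernel from the exact sequence, without comparing it with `K`
  -- itself.
  let eC : (K.leftDerived 0).obj X ≅ cokernel (α.app X) :=
    (cokernelIsCokernel (α.app X)).coconePointUniqueUpToIso exc.gIsCokernel |>.symm
  let ed : ∀ n, (K.leftDerived (n + 2)).obj X ≅ (T₁.leftDerived (n + 1)).obj X :=
    fun n => @asIso _ _ _ _ (d (n + 1)) (hiso n)
  have F₁ := fun n => (ShortComplex.ShortExact.moduleCat_exact_iff_function_exact _).1 (ex₁' n)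
  have F₂ := fun n => (ShortComplex.ShortExact.moduleCat_exact_iff_function_exact _).1 (ex₂' n)
  have F₃ := fun n => (ShortComplex.ShortExact.moduleCat_exact_iff_function_exact _).1 (ex₃' n)
  refine ⟨fun n => (ed n).inv ≫ d' (n + 1), fun n => (NatTrans.leftDerived γ n).app X,
    fun n => (NatTrans.leftDerived θ (n + 2)).app X ≫ (ed n).hom,
    (NatTrans.leftDerived θ 1).app X ≫ eN.hom, eN.inv ≫ d' 0,
    (NatTrans.leftDerived θ 0).app X ≫ eC.hom, fun n => ?_, fun n => ?_, fun n => ?_,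
    ?_, ?_, ?_, ?_, ?_⟩
  · simpa using exact_iso_comp (F₁ (n + 1)) (ed n).symm (Iso.refl _) (Iso.refl _)
  · simpa using exact_iso_comp (F₂ (n + 2)) (Iso.refl _) (Iso.refl _) (ed n)
  · simpa using exact_iso_comp (F₃ (n + 1)) (Iso.refl _) (ed n) (Iso.refl _)
  · simpa using exact_iso_comp (F₂ 1) (Iso.refl _) (Iso.refl _) eN
  · simpa using exact_iso_comp (F₃ 0) (Iso.refl _) eN (Iso.refl _)
  · simpa using exact_iso_comp (F₁ 0) eN.symm (Iso.refl _) (Iso.refl _)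
  · simpa using exact_iso_comp (F₂ 0) (Iso.refl _) (Iso.refl _) eC
  · exact (ModuleCat.epi_iff_surjective _).1 inferInstance

end Modules

/-! ### Pullback along poset maps with a partial right adjoint -/

section Pullback

variable {R : Type v} [CommRing R] {P Q : Type u} [PartialOrder P] [PartialOrder Q]

theorem Sheaf.naturality_str {F G : Sheaf.{u, v, w} R P} (φ : F ⟶ G) {x y : P} (h : x ≤ y) :
    F.str h ≫ φ.app (op x) = φ.app (op y) ≫ G.str h :=
  φ.naturality _

theorem Sheaf.naturality_str_apply {F G : Sheaf.{u, v, w} R P} (φ : F ⟶ G) {x y : P} (h : x ≤ y)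
    (s : F.obj (op y)) : φ.app (op x) (F.str h s) = G.str h (φ.app (op y) s) :=
  ConcreteCategory.congr_hom (Sheaf.naturality_str φ h) s

theorem Sheaf.str_comp_apply (F : Sheaf.{u, v, w} R P) {x y z : P} (h : x ≤ y) (h' : y ≤ z)
    (s : F.obj (op z)) : F.str h (F.str h' s) = F.str (h.trans h') s :=
  ConcreteCategory.congr_hom (F.str_comp h h') s

theorem Sheaf.str_refl_apply (F : Sheaf.{u, v, w} R P) {x : P} (h : x ≤ x)
    (s : F.obj (op x)) : F.str h s = s :=
  ConcreteCategory.congr_hom (F.str_refl h) s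

theorem Sheaf.app_surjective {F G : Sheaf.{u, v, w} R P} (φ : F ⟶ G) [Epi φ] (x : Pᵒᵖ) :
    Function.Surjective (φ.app x) :=
  (ModuleCat.epi_iff_surjective _).1 inferInstance

theorem Sheaf.epi_of_app_surjective {F G : Sheaf.{u, v, w} R P} (φ : F ⟶ G)
    (h : ∀ x, Function.Surjective (φ.app x)) : Epi φ :=
  have : ∀ x, Epi (φ.app x) := fun x => (ModuleCat.epi_iff_surjective _).2 (h x)
  NatTrans.epi_of_epi_app φ

/-- Pulling back sheaves along a poset map, as a functor. -/
def pullbackFunctor (R : Type v) [CommRing R] (f : Q →o P) :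
    Sheaf.{u, v, w} R P ⥤ Sheaf.{u, v, w} R Q :=
  (Functor.whiskeringLeft _ _ _).obj f.monotone.functor.op

instance (f : Q →o P) : (pullbackFunctor.{u, v, w} R f).Additive where

instance (f : Q →o P) : PreservesFiniteLimits (pullbackFunctor.{u, v, w} R f) :=
  have : HasFiniteLimits (ModuleCat.{w} R) := Abelian.hasFiniteLimits
  ⟨fun J _ _ => whiskeringLeft_preservesLimitsOfShape J f.monotone.functor.op⟩

instance (f : Q →o P) : PreservesFiniteColimits (pullbackFunctor.{u, v, w} R f) :=
  have : HasFiniteColimits (ModuleCat.{w} R) := Abelian.hasFiniteColimits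
  ⟨fun J _ _ => whiskeringLeft_preservesColimitsOfShape J f.monotone.functor.op⟩

/-- A right adjoint of a poset map `f`, defined only on a part of the target: for each `x` the set
`{q | f q ≤ x}` is empty or has a greatest element. -/
structure PartialRightAdjoint (f : Q →o P) where
  /-- The domain of the adjoint. -/
  dom : P → Prop
  /-- The value of the adjoint. -/
  val : ∀ x, dom x → Q
  le_iff : ∀ q x, f q ≤ x ↔ ∃ h : dom x, q ≤ val x h

namespace PartialRightAdjoint

variable {f : Q →o P} (ρ : PartialRightAdjoint f)

theorem map_val_le {x : P} (h : ρ.dom x) : f (ρ.val x h) ≤ x :=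
  (ρ.le_iff _ _).2 ⟨h, le_rfl⟩

theorem dom_map (q : Q) : ρ.dom (f q) :=
  ((ρ.le_iff q (f q)).1 le_rfl).1

theorem le_val_map (q : Q) : q ≤ ρ.val (f q) (ρ.dom_map q) :=
  ((ρ.le_iff q (f q)).1 le_rfl).2

theorem dom_mono {x y : P} (hxy : x ≤ y) (h : ρ.dom x) : ρ.dom y :=
  ((ρ.le_iff _ _).1 ((ρ.map_val_le h).trans hxy)).1

theorem val_mono {x y : P} (hxy : x ≤ y) (h : ρ.dom x) : ρ.val x h ≤ ρ.val y (ρ.dom_mono hxy h) :=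
  ((ρ.le_iff _ _).1 ((ρ.map_val_le h).trans hxy)).2

/-- The right Kan extension of a sheaf along a poset map with a partial right adjoint. -/
def extend (G : Sheaf.{u, v, w} R Q) : Sheaf.{u, v, w} R P where
  obj x := ModuleCat.of R (∀ h : PLift (ρ.dom x.unop), G.obj (op (ρ.val x.unop h.down)))
  map {x y} g := ModuleCat.ofHom <| LinearMap.pi fun h =>
    (G.str (ρ.val_mono (leOfHom g.unop) h.down)).hom ∘ₗ
      LinearMap.proj (PLift.up (ρ.dom_mono (leOfHom g.unop) h.down))
  map_id x := by
    refine ModuleCat.hom_ext (LinearMap.ext fun s => funext fun h => ?_)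
    exact G.str_refl_apply _ _
  map_comp {x y z} g g' := by
    refine ModuleCat.hom_ext (LinearMap.ext fun s => funext fun h => ?_)
    exact (G.str_comp_apply _ _ _).symm

/-- The functoriality of `PartialRightAdjoint.extend`. -/
def extendMap {G G' : Sheaf.{u, v, w} R Q} (e : G ⟶ G') : ρ.extend G ⟶ ρ.extend G' where
  app x := ModuleCat.ofHom <| LinearMap.pi fun h =>
    (e.app (op (ρ.val x.unop h.down))).hom ∘ₗ LinearMap.proj h
  naturality {x y} g := by
    refine ModuleCat.hom_ext (LinearMap.ext fun s => funext fun h => ?_)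
    exact Sheaf.naturality_str_apply e _ _

/-- The value of `ρ.extend G` at `x` is a product indexed by the proofs of `ρ.dom x`: one value of
`G`, or zero. Surjectivity can thus be checked pointwise, with no higher limits in the way. -/
instance {G G' : Sheaf.{u, v, w} R Q} (e : G ⟶ G') [Epi e] : Epi (ρ.extendMap e) := by
  refine Sheaf.epi_of_app_surjective _ fun x s => ?_
  choose t ht using fun h => Sheaf.app_surjective e (op (ρ.val x.unop (PLift.down h))) (s h)
  exact ⟨t, funext ht⟩

/-- The adjunct `F ⟶ f_* G` of a map `f^* F ⟶ G`. -/
def adjunct {F : Sheaf.{u, v, w} R P} {G : Sheaf.{u, v, w} R Q} (φ : F.pullback f ⟶ G) :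
    F ⟶ ρ.extend G where
  app x := ModuleCat.ofHom <| LinearMap.pi fun h =>
    (φ.app (op (ρ.val x.unop h.down))).hom ∘ₗ (F.str (ρ.map_val_le h.down)).hom
  naturality {x y} g := by
    refine ModuleCat.hom_ext (LinearMap.ext fun s => funext fun h => ?_)
    refine Eq.trans ?_ (Sheaf.naturality_str_apply φ (ρ.val_mono (leOfHom g.unop) h.down) _)
    refine congrArg (φ.app (op (ρ.val y.unop h.down))) ?_
    exact (F.str_comp_apply (ρ.map_val_le h.down) (leOfHom g.unop) s).trans
      (F.str_comp_apply _ _ s).symm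

/-- The counit `f^* f_* G ⟶ G`. -/
def counit (G : Sheaf.{u, v, w} R Q) : (ρ.extend G).pullback f ⟶ G where
  app q := (ModuleCat.ofHom (LinearMap.proj (PLift.up (ρ.dom_map q.unop))) :
    _ ⟶ G.obj (op (ρ.val (f q.unop) (ρ.dom_map q.unop)))) ≫ G.str (ρ.le_val_map q.unop)
  naturality {q q'} g := by
    refine ModuleCat.hom_ext (LinearMap.ext fun s => ?_)
    exact (G.str_comp_apply _ _ _).trans
      (G.str_comp_apply (leOfHom g.unop) (ρ.le_val_map q.unop) _).symm

/-- Pullback is left adjoint to `ρ.extend`, which preserves epimorphisms. A lifting problem out of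
`f^* F` is transposed to one out of `F`, solved there, and brought back by the counit. -/
theorem preservesProjectiveObjects (ρ : PartialRightAdjoint f) :
    (pullbackFunctor.{u, v, w} R f).PreservesProjectiveObjects where
  projective_obj {F} hF := by
    refine ⟨fun {E G} φ e he => ?_⟩
    let ψ : F ⟶ ρ.extend E := Projective.factorThru (ρ.adjunct φ) (ρ.extendMap e)
    have hψ : ψ ≫ ρ.extendMap e = ρ.adjunct φ := Projective.factorThru_comp _ _
    refine ⟨(pullbackFunctor R f).map ψ ≫ ρ.counit E, ?_⟩
    ext q s
    have h : e.app (op (ρ.val (f q.unop) (ρ.dom_map q.unop)))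
        (ψ.app (op (f q.unop)) s (PLift.up (ρ.dom_map q.unop))) =
        φ.app (op (ρ.val (f q.unop) (ρ.dom_map q.unop)))
          (F.str (ρ.map_val_le (ρ.dom_map q.unop)) s) :=
      congrFun (ConcreteCategory.congr_hom (congrArg (fun η => η.app (op (f q.unop))) hψ) s)
        (PLift.up (ρ.dom_map q.unop))
    -- Naturality of `e` and `φ` reduces the triangle identity to the round trip from `f q` to `f
    -- (ρ.val (f q))` and back; these elements are `≤` each other, so the structure maps compose to
    -- the identity.
    refine (Sheaf.naturality_str_apply e (ρ.le_val_map q.unop) _).trans ?_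
    refine (congrArg (G.str (ρ.le_val_map q.unop)) h).trans ?_
    refine (Sheaf.naturality_str_apply φ (ρ.le_val_map q.unop) _).symm.trans ?_
    refine congrArg (φ.app q) ?_
    exact (F.str_comp_apply _ _ s).trans (F.str_refl_apply le_rfl s)

/-- The homology of a pullback as a left derived functor on the sheaves on the target. -/
def homologyIso [Finite P] [Finite Q] [Small.{w} R] (F : Sheaf.{u, v, w} R P) (n : ℕ) :
    ((pullbackFunctor R f ⋙ colim).leftDerived n).obj F ≅ homology (F.pullback f) n :=
  have := ρ.preservesProjectiveObjects (R := R)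
  leftDerivedCompIso (pullbackFunctor R f) colim F n

end PartialRightAdjoint

end Pullback

/-! ### Coinduced sheaves and extension of colimit maps on projectives -/

section Coinduced

variable {R : Type v} [CommRing R] {P Q : Type u} [PartialOrder P] [PartialOrder Q]

/-- The sheaf with value `M` on the upper set `{x | D x}` and `0` elsewhere. -/
def coinduced {D : P → Prop} (hD : ∀ ⦃x y⦄, x ≤ y → D x → D y) (M : ModuleCat.{w} R) :
    Sheaf.{u, v, w} R P where
  obj x := ModuleCat.of R (PLift (D x.unop) → M)
  map {x y} g := ModuleCat.ofHom <| LinearMap.funLeft R M fun h =>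
    PLift.up (hD (leOfHom g.unop) h.down)

/-- The restriction of a coinduced sheaf to a smaller upper set. -/
def coinducedRestrict {D D' : P → Prop} (hD : ∀ ⦃x y⦄, x ≤ y → D x → D y)
    (hD' : ∀ ⦃x y⦄, x ≤ y → D' x → D' y) (h : ∀ x, D x → D' x) (M : ModuleCat.{w} R) :
    coinduced hD' M ⟶ coinduced hD M where
  app x := ModuleCat.ofHom <| LinearMap.funLeft R M fun hx => PLift.up (h _ hx.down)

instance {D D' : P → Prop} (hD : ∀ ⦃x y⦄, x ≤ y → D x → D y)
    (hD' : ∀ ⦃x y⦄, x ≤ y → D' x → D' y) (h : ∀ x, D x → D' x) (M : ModuleCat.{w} R) :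
    Epi (coinducedRestrict hD hD' h M) :=
  Sheaf.epi_of_app_surjective _ fun _ =>
    LinearMap.funLeft_surjective_of_injective R M _ fun _ _ _ => Subsingleton.elim _ _

theorem Sheaf.str_colimit_ι (F : Sheaf.{u, v, w} R P) [HasColimit F] {x y : P} (h : x ≤ y) :
    F.str h ≫ colimit.ι F (op x) = colimit.ι F (op y) :=
  colimit.w F _

variable {f : Q →o P} (ρ : PartialRightAdjoint f) [Finite Q]

/-- The functor `F ↦ colim f^* F`. -/
abbrev pullbackColim (R : Type v) [CommRing R] (f : Q →o P) :
    Sheaf.{u, v, w} R P ⥤ ModuleCat.{w} R :=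
  pullbackFunctor R f ⋙ colim

/-- The structure map `F(f q) ⟶ colim f^* F`. -/
def Sheaf.pullbackι (F : Sheaf.{u, v, w} R P) (f : Q →o P) (q : Q) :
    F.obj (op (f q)) ⟶ (pullbackColim R f).obj F :=
  colimit.ι (F.pullback f) (op q)

theorem Sheaf.str_pullbackι (F : Sheaf.{u, v, w} R P) (f : Q →o P) {q q' : Q} (h : q ≤ q')
    (h' : f q ≤ f q') : F.str h' ≫ F.pullbackι f q = F.pullbackι f q' :=
  (F.pullback f).str_colimit_ι h

theorem Sheaf.pullbackColim_hom_ext {F : Sheaf.{u, v, w} R P} {f : Q →o P} {M : ModuleCat.{w} R}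
    {φ ψ : (pullbackColim R f).obj F ⟶ M}
    (h : ∀ q, F.pullbackι f q ≫ φ = F.pullbackι f q ≫ ψ) : φ = ψ :=
  colimit.hom_ext (F := F.pullback f) fun q => h q.unop

theorem Sheaf.pullbackι_map {F G : Sheaf.{u, v, w} R P} (φ : F ⟶ G) (f : Q →o P) (q : Q) :
    F.pullbackι f q ≫ (pullbackColim R f).map φ = φ.app (op (f q)) ≫ G.pullbackι f q :=
  ι_colimMap _ _

/-- The structure maps of the colimit of `f^* F`, as a map from `F` to a coinduced sheaf. -/
def PartialRightAdjoint.toCoinduced (F : Sheaf.{u, v, w} R P) :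
    F ⟶ coinduced (fun _ _ => ρ.dom_mono) ((pullbackColim R f).obj F) where
  app x := ModuleCat.ofHom <| LinearMap.pi fun h =>
    (F.str (ρ.map_val_le h.down) ≫ F.pullbackι f (ρ.val x.unop h.down)).hom
  naturality {x y} g := by
    refine ModuleCat.hom_ext (LinearMap.ext fun s => funext fun h => ?_)
    have hg := leOfHom g.unop
    have key : F.str hg ≫ F.str (ρ.map_val_le h.down) ≫ F.pullbackι f (ρ.val y.unop h.down) =
        F.str (ρ.map_val_le (ρ.dom_mono hg h.down)) ≫
          F.pullbackι f (ρ.val x.unop (ρ.dom_mono hg h.down)) := by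
      rw [← F.str_pullbackι f (ρ.val_mono hg h.down) (f.monotone (ρ.val_mono hg h.down)),
        ← Category.assoc, ← Category.assoc, F.str_comp, F.str_comp]
    exact ConcreteCategory.congr_hom key s

/-- For a projective sheaf, the structure maps of the colimit of `f^* F` extend to any upper set
which contains the domain of the partial right adjoint. -/
theorem PartialRightAdjoint.exists_extension (F : Sheaf.{u, v, w} R P) [Projective F]
    {D : P → Prop} (hD : ∀ ⦃x y⦄, x ≤ y → D x → D y) (h : ∀ x, ρ.dom x → D x) :
    ∃ ψ : ∀ x, D x → (F.obj (op x) ⟶ (pullbackColim R f).obj F),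
      (∀ x y (hxy : x ≤ y) (hx : D x), F.str hxy ≫ ψ x hx = ψ y (hD hxy hx)) ∧
      ∀ q, ψ (f q) (h _ (ρ.dom_map q)) = F.pullbackι f q := by
  let M := (pullbackColim R f).obj F
  let r := coinducedRestrict (fun _ _ => ρ.dom_mono) hD h M
  -- A map from `F` to a coinduced sheaf is a compatible family of maps `F(x) ⟶ M` on the upper set,
  -- so extending the family to `D` means lifting along the epimorphism `r`.
  let ψ : F ⟶ coinduced hD M := Projective.factorThru (ρ.toCoinduced F) r
  have hψ : ψ ≫ r = ρ.toCoinduced F := Projective.factorThru_comp _ _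
  let p : ∀ x (hx : D x), (coinduced hD M).obj (op x) ⟶ M :=
    fun x hx => ModuleCat.ofHom (LinearMap.proj (PLift.up hx))
  refine ⟨fun x hx => ψ.app (op x) ≫ p x hx, fun x y hxy hx => ?_, fun q => ?_⟩
  · refine ModuleCat.hom_ext (LinearMap.ext fun s => ?_)
    exact congrFun (Sheaf.naturality_str_apply ψ hxy s) (PLift.up hx)
  · have h₁ : ψ.app (op (f q)) ≫ p (f q) (h _ (ρ.dom_map q)) =
        F.str (ρ.map_val_le (ρ.dom_map q)) ≫ F.pullbackι f (ρ.val (f q) (ρ.dom_map q)) := by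
      refine ModuleCat.hom_ext (LinearMap.ext fun s => ?_)
      exact congrFun (ConcreteCategory.congr_hom
        (congrArg (fun η => η.app (op (f q))) hψ) s) (PLift.up (ρ.dom_map q))
    refine h₁.trans ?_
    rw [← F.str_pullbackι f (ρ.le_val_map q) (f.monotone (ρ.le_val_map q)), ← Category.assoc,
      F.str_comp, F.str_refl, Category.id_comp]

end Coinduced

/-! ### The two short exact sequences at a minimal element -/

section MinimalElement

variable {R : Type v} [CommRing R] {P U Q : Type u} [PartialOrder P] [PartialOrder U]
  [PartialOrder Q] [Finite U] [Finite Q]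

/-- The map `colim j^* F ⟶ F(a)` given by the structure maps, for `j` with values `≥ a`. -/
def Sheaf.pullbackColimToEval (F : Sheaf.{u, v, w} R P) {a : P} (j : U →o P)
    (hj : ∀ q, a ≤ j q) : (pullbackColim R j).obj F ⟶ F.obj (op a) :=
  colimit.desc (F.pullback j)
    { pt := F.obj (op a)
      ι :=
        { app := fun q => F.str (hj q.unop)
          naturality := fun _ _ _ => (F.str_comp _ _).trans (Category.comp_id _).symm } }

theorem Sheaf.pullbackι_toEval (F : Sheaf.{u, v, w} R P) {a : P} (j : U →o P)
    (hj : ∀ q, a ≤ j q) (q : U) : F.pullbackι j q ≫ F.pullbackColimToEval j hj = F.str (hj q) :=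
  colimit.ι_desc _ _

/-- The map `colim j^* F ⟶ F(a)`, as a natural transformation. -/
def colimToEval (R : Type v) [CommRing R] {a : P} (j : U →o P) (hj : ∀ q, a ≤ j q) :
    pullbackColim.{u, v, w} R j ⟶ (evaluation _ _).obj (op a) where
  app F := Sheaf.pullbackColimToEval F j hj
  naturality {F G} φ := by
    refine Sheaf.pullbackColim_hom_ext fun q => ?_
    rw [← Category.assoc, Sheaf.pullbackι_map, Category.assoc, Sheaf.pullbackι_toEval,
      ← Category.assoc, Sheaf.pullbackι_toEval]
    exact (Sheaf.naturality_str φ (hj q)).symm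

theorem pullbackι_colimToEval {a : P} (j : U →o P) (hj : ∀ q, a ≤ j q) (F : Sheaf.{u, v, w} R P)
    (q : U) : F.pullbackι j q ≫ (colimToEval R j hj).app F = F.str (hj q) :=
  F.pullbackι_toEval j hj q

/-- The functor `F ↦ coker (colim j^* F ⟶ F(a))`. -/
def cokerEval (R : Type v) [CommRing R] {a : P} (j : U →o P) (hj : ∀ q, a ≤ j q) :
    Sheaf.{u, v, w} R P ⥤ ModuleCat.{w} R :=
  cokernel (colimToEval.{u, v, w} R j hj)

/-- The projection `F(a) ⟶ coker (colim j^* F ⟶ F(a))`. -/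
def cokerEvalπ (R : Type v) [CommRing R] {a : P} (j : U →o P) (hj : ∀ q, a ≤ j q) :
    (evaluation _ _).obj (op a) ⟶ cokerEval.{u, v, w} R j hj :=
  cokernel.π (colimToEval.{u, v, w} R j hj)

instance {a : P} (j : U →o P) (hj : ∀ q, a ≤ j q) : Epi (cokerEvalπ.{u, v, w} R j hj) :=
  inferInstanceAs (Epi (cokernel.π _))

theorem colimToEval_comp_cokerEvalπ {a : P} (j : U →o P) (hj : ∀ q, a ≤ j q) :
    colimToEval.{u, v, w} R j hj ≫ cokerEvalπ R j hj = 0 :=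
  cokernel.condition _

theorem colimToEval_app_comp_cokerEvalπ_app {a : P} (j : U →o P) (hj : ∀ q, a ≤ j q)
    (F : Sheaf.{u, v, w} R P) : (colimToEval R j hj).app F ≫ (cokerEvalπ R j hj).app F = 0 := by
  rw [← NatTrans.comp_app, colimToEval_comp_cokerEvalπ, zero_app]

theorem colimToEval_exact {a : P} (j : U →o P) (hj : ∀ q, a ≤ j q) (F : Sheaf.{u, v, w} R P) :
    (ShortComplex.mk ((colimToEval R j hj).app F) ((cokerEvalπ R j hj).app F)
      (colimToEval_app_comp_cokerEvalπ_app j hj F)).Exact :=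
  (ShortComplex.exact_cokernel (colimToEval R j hj)).map ((evaluation _ _).obj F)

instance {a : P} (j : U →o P) (hj : ∀ q, a ≤ j q) : (cokerEval.{u, v, w} R j hj).Additive where
  map_add {F G φ ψ} := by
    rw [← cancel_epi ((cokerEvalπ R j hj).app F), Preadditive.comp_add]
    simp only [← NatTrans.naturality]
    rw [← Preadditive.add_comp]
    rfl

/-- Above `a`, the structure maps to `F(a)` vanish in the cokernel of `colim j^* F ⟶ F(a)`. -/
theorem str_cokerEvalπ_eq_zero {a : P} (j : U →o P) (hj : ∀ q, a ≤ j q)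
    (hj' : ∀ x, a < x → ∃ q, j q = x) (F : Sheaf.{u, v, w} R P) {x : P} (hx : a < x) :
    F.str hx.le ≫ (cokerEvalπ R j hj).app F = 0 := by
  obtain ⟨q, rfl⟩ := hj' x hx
  rw [← pullbackι_colimToEval j hj F q, Category.assoc, colimToEval_app_comp_cokerEvalπ_app,
    comp_zero]

variable {a : P} (hmin : ∀ x, x ≤ a → x = a) (j : U →o P) (hj : ∀ q, a ≤ j q)
    (hj' : ∀ x, a < x → ∃ q, j q = x)

open Classical in
/-- The map `F(x) ⟶ coker (colim j^* F ⟶ F(a))` which is zero unless `x = a`. -/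
def Sheaf.toCokerEval (F : Sheaf.{u, v, w} R P) {a : P} (j : U →o P) (hj : ∀ q, a ≤ j q) (x : P) :
    F.obj (op x) ⟶ (cokerEval R j hj).obj F :=
  if h : a ≤ x then F.str h ≫ (cokerEvalπ R j hj).app F else 0

theorem Sheaf.toCokerEval_of_le (F : Sheaf.{u, v, w} R P) {x : P} (h : a ≤ x) :
    F.toCokerEval j hj x = F.str h ≫ (cokerEvalπ R j hj).app F :=
  dif_pos h

theorem Sheaf.toCokerEval_of_ne (hj' : ∀ x, a < x → ∃ q, j q = x) (F : Sheaf.{u, v, w} R P)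
    {x : P} (h : x ≠ a) :
    F.toCokerEval j hj x = 0 := by
  by_cases hx : a ≤ x
  · rw [F.toCokerEval_of_le j hj hx, str_cokerEvalπ_eq_zero j hj hj' F (hx.lt_of_ne h.symm)]
  · exact dif_neg hx

/-- This cocone condition is where minimality of `a` enters: if `x ≠ a` and `x ≤ y`, then `y ≠ a`,
so both sides vanish. -/
theorem Sheaf.str_toCokerEval (hmin : ∀ x, x ≤ a → x = a) (hj' : ∀ x, a < x → ∃ q, j q = x)
    (F : Sheaf.{u, v, w} R P) {x y : P} (h : x ≤ y) :
    F.str h ≫ F.toCokerEval j hj x = F.toCokerEval j hj y := by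
  by_cases hx : x = a
  · subst hx
    rw [F.toCokerEval_of_le j hj h, F.toCokerEval_of_le j hj le_rfl, F.str_refl, Category.id_comp]
  · have hy : y ≠ a := fun e => hx (hmin x (h.trans e.le))
    rw [Sheaf.toCokerEval_of_ne j hj hj' F hx, Sheaf.toCokerEval_of_ne j hj hj' F hy, comp_zero]

theorem Sheaf.app_toCokerEval {F G : Sheaf.{u, v, w} R P} (φ : F ⟶ G) (x : P) :
    φ.app (op x) ≫ G.toCokerEval j hj x = F.toCokerEval j hj x ≫ (cokerEval R j hj).map φ := by
  by_cases hx : a ≤ x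
  · rw [F.toCokerEval_of_le j hj hx, G.toCokerEval_of_le j hj hx, Category.assoc,
      ← NatTrans.naturality, ← Category.assoc, ← Sheaf.naturality_str φ hx, Category.assoc]
    rfl
  · rw [Sheaf.toCokerEval, Sheaf.toCokerEval, dif_neg hx, dif_neg hx, comp_zero, zero_comp]

/-- Only injectivity needs projectivity. Extending the maps `F(j q) ⟶ colim j^* F` to the upper set
of `a` yields, at `a` itself, a retraction `F(a) ⟶ colim j^* F`. -/
theorem colimToEval_shortExact (ρ : PartialRightAdjoint j) (hρ : ∀ x, ρ.dom x → a ≤ x)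
    (F : Sheaf.{u, v, w} R P) [Projective F] :
    (ShortComplex.mk ((colimToEval R j hj).app F) ((cokerEvalπ R j hj).app F)
      (colimToEval_app_comp_cokerEvalπ_app j hj F)).ShortExact := by
  obtain ⟨ψ, hψ, hψ'⟩ := ρ.exists_extension F (D := (a ≤ ·)) (fun _ _ h h' => h'.trans h) hρ
  have h : (colimToEval R j hj).app F ≫ (ψ a le_rfl : F.obj (op a) ⟶ _) = 𝟙 _ := by
    refine Sheaf.pullbackColim_hom_ext fun q => ?_
    rw [← Category.assoc, pullbackι_colimToEval, Category.comp_id, ← hψ' q]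
    exact hψ _ _ _ _
  have : Mono ((colimToEval R j hj).app F) := mono_of_mono_fac h
  exact
    { exact := colimToEval_exact j hj F
      mono_f := this
      epi_g := inferInstanceAs (Epi ((cokerEvalπ R j hj).app F)) }

variable [Finite P]

/-- The map `colim f^* F ⟶ colim F`. -/
def Sheaf.pullbackColimPre (F : Sheaf.{u, v, w} R P) (f : Q →o P) :
    (pullbackColim R f).obj F ⟶ colimit F :=
  colimit.pre F f.monotone.functor.op

theorem Sheaf.pullbackι_pre (F : Sheaf.{u, v, w} R P) (f : Q →o P) (q : Q) :
    F.pullbackι f q ≫ F.pullbackColimPre f = colimit.ι F (op (f q)) :=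
  colimit.ι_pre F f.monotone.functor.op (op q)

/-- The map `colim f^* F ⟶ colim F`, as a natural transformation. -/
def colimPre (R : Type v) [CommRing R] (f : Q →o P) :
    pullbackColim.{u, v, w} R f ⟶ (colim : Sheaf.{u, v, w} R P ⥤ _) where
  app F := Sheaf.pullbackColimPre F f
  naturality {F G} φ := by
    refine Sheaf.pullbackColim_hom_ext fun q => ?_
    rw [← Category.assoc, Sheaf.pullbackι_map, Category.assoc]
    refine (congrArg (_ ≫ ·) (Sheaf.pullbackι_pre G f q)).trans ?_
    refine (ι_colimMap φ _).symm.trans ?_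
    exact (congrArg (· ≫ colimMap φ) (Sheaf.pullbackι_pre F f q).symm).trans (Category.assoc _ _ _)

theorem pullbackι_colimPre (f : Q →o P) (F : Sheaf.{u, v, w} R P) (q : Q) :
    F.pullbackι f q ≫ (colimPre R f).app F = colimit.ι F (op (f q)) :=
  F.pullbackι_pre f q

/-- The map `colim F ⟶ coker (colim j^* F ⟶ F(a))` which collapses everything but `F(a)`. -/
def colimToCokerEval (R : Type v) [CommRing R] {a : P} (hmin : ∀ x, x ≤ a → x = a) (j : U →o P)
    (hj : ∀ q, a ≤ j q) (hj' : ∀ x, a < x → ∃ q, j q = x) :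
    (colim : Sheaf.{u, v, w} R P ⥤ _) ⟶ cokerEval R j hj where
  app F := colimit.desc F
    { pt := (cokerEval R j hj).obj F
      ι :=
        { app := fun x => Sheaf.toCokerEval F j hj x.unop
          naturality := fun _ _ g =>
            (Sheaf.str_toCokerEval j hj hmin hj' F (leOfHom g.unop)).trans
              (Category.comp_id _).symm } }
  naturality {F G} φ := by
    refine colimit.hom_ext fun x => ?_
    refine (ι_colimMap_assoc _ _ _).trans ?_
    refine (congrArg (_ ≫ ·) (colimit.ι_desc _ _)).trans ?_
    refine Eq.trans ?_ (colimit.ι_desc_assoc _ _ _).symm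
    exact Sheaf.app_toCokerEval j hj φ x.unop

theorem ι_colimToCokerEval (F : Sheaf.{u, v, w} R P) (x : P) :
    colimit.ι F (op x) ≫ (colimToCokerEval R hmin j hj hj').app F = F.toCokerEval j hj x :=
  colimit.ι_desc _ _

theorem colimPre_comp_colimToCokerEval (i : Q →o P) (hi : ∀ q, i q ≠ a) :
    colimPre.{u, v, w} R i ≫ colimToCokerEval R hmin j hj hj' = 0 := by
  refine NatTrans.ext (funext fun F => Sheaf.pullbackColim_hom_ext fun q => ?_)
  rw [NatTrans.comp_app, zero_app, comp_zero, ← Category.assoc, pullbackι_colimPre]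
  exact (ι_colimToCokerEval hmin j hj hj' F _).trans (Sheaf.toCokerEval_of_ne j hj hj' F (hi q))

/-- Extending the cocone of `colim i^* F` to all of `P` gives a retraction of `colim F` onto `colim
i^* F`. For the cokernel, each `F(x)` with `x ≠ a` reaches `colim F` through the image of `i`;
killing that image leaves `F(a)` modulo what comes from above `a`. -/
theorem colimPre_shortExact (i : Q →o P) (ρ : PartialRightAdjoint i)
    (hρ : ∀ x, ρ.dom x ↔ x ≠ a) (hja : ∀ q, j q ≠ a) (F : Sheaf.{u, v, w} R P) [Projective F]
    (w : (colimPre R i).app F ≫ (colimToCokerEval R hmin j hj hj').app F = 0) :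
    (ShortComplex.mk ((colimPre R i).app F) ((colimToCokerEval R hmin j hj hj').app F)
      w).ShortExact := by
  obtain ⟨ψ, hψ, hψ'⟩ := ρ.exists_extension F (D := fun _ => True) (fun _ _ _ _ => trivial)
    (fun _ _ => trivial)
  let r : colimit F ⟶ (pullbackColim R i).obj F := colimit.desc F
    { pt := (pullbackColim R i).obj F
      ι :=
        { app := fun x => ψ x.unop trivial
          naturality := fun _ _ g =>
            (hψ _ _ (leOfHom g.unop) trivial).trans (Category.comp_id _).symm } }
  have h : (colimPre R i).app F ≫ r = 𝟙 _ := by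
    refine Sheaf.pullbackColim_hom_ext fun q => ?_
    rw [← Category.assoc, pullbackι_colimPre, Category.comp_id, ← hψ' q]
    exact colimit.ι_desc _ _
  have hmono : Mono ((colimPre R i).app F) := mono_of_mono_fac h
  have hπ : colimit.ι F (op a) ≫ (colimToCokerEval R hmin j hj hj').app F =
      (cokerEvalπ R j hj).app F := by
    rw [ι_colimToCokerEval, F.toCokerEval_of_le j hj le_rfl, F.str_refl]
    exact Category.id_comp _
  have hepi : Epi ((colimToCokerEval R hmin j hj hj').app F) :=
    epi_of_epi_fac hπ
  refine { exact := ?_, mono_f := hmono, epi_g := hepi }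
  have hc : Epi (ShortComplex.mk ((colimToEval R j hj).app F) ((cokerEvalπ R j hj).app F)
      (colimToEval_app_comp_cokerEvalπ_app j hj F)).g :=
    inferInstanceAs (Epi ((cokerEvalπ R j hj).app F))
  -- The universal property of the cokernel: a map on `colim F` killed by `colim i^* F` is
  -- determined by its component at `a`, which descends to `K(F)`.
  have key : ∀ {M : ModuleCat.{w} R} (k : colimit F ⟶ M), (colimPre R i).app F ≫ k = 0 →
      ∃ l, (colimToCokerEval R hmin j hj hj').app F ≫ l = k := by
    intro M k hk
    have hk' : ∀ x, x ≠ a → colimit.ι F (op x) ≫ k = 0 := by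
      intro x hx
      have hd := (hρ x).2 hx
      rw [← F.str_colimit_ι (ρ.map_val_le hd), ← pullbackι_colimPre, Category.assoc,
        Category.assoc, hk, comp_zero, comp_zero]
    have hk₀ : (colimToEval R j hj).app F ≫ (colimit.ι F (op a) ≫ k) = 0 := by
      refine Sheaf.pullbackColim_hom_ext fun q => ?_
      rw [← Category.assoc, pullbackι_colimToEval, comp_zero, ← Category.assoc, F.str_colimit_ι]
      exact hk' _ (hja q)
    refine ⟨(colimToEval_exact j hj F).desc _ hk₀, colimit.hom_ext fun x => ?_⟩
    have hl : (cokerEvalπ R j hj).app F ≫ (colimToEval_exact j hj F).desc _ hk₀ =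
      colimit.ι F (op a) ≫ k := (colimToEval_exact j hj F).g_desc _ hk₀
    rw [← Category.assoc]
    by_cases hx : x.unop = a
    · obtain rfl : x = op a := congrArg op hx
      rw [hπ, hl]
    · refine (congrArg (· ≫ _) ((ι_colimToCokerEval hmin j hj hj' F x.unop).trans
        (Sheaf.toCokerEval_of_ne j hj hj' F hx))).trans ?_
      rw [zero_comp]
      exact (hk' x.unop hx).symm
  exact ShortComplex.exact_of_g_is_cokernel _ (CokernelCofork.IsColimit.ofπ _ _
    (fun k hk => (key k hk).choose) (fun k hk => (key k hk).choose_spec)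
    (fun k hk _ hm => (cancel_epi _).1 (hm.trans (key k hk).choose_spec.symm)))

end MinimalElement

/-! ### The colimit as the cokernel of `S_1 ⟶ S_0` -/

section ZerothHomology

variable {R : Type v} [CommRing R] {P : Type u} [PartialOrder P]

/-- The `0`-simplex `x`. -/
@[simps]
def Simplex.point (x : P) : Simplex P 0 where
  vertex _ := x
  antitone _ _ _ := le_rfl

theorem Simplex.eq_point (σ : Simplex P 0) : σ = Simplex.point (σ.vertex 0) := by
  ext i
  exact congrArg σ.vertex (Fin.fin_one_eq_zero i)

/-- The `1`-simplex `x ≤ y`. -/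
def Simplex.edge {x y : P} (h : x ≤ y) : Simplex P 1 where
  vertex := ![y, x]
  antitone := by
    intro i j hij
    fin_cases i <;> fin_cases j
    · exact le_rfl
    · exact h
    · exact absurd hij (by decide)
    · exact le_rfl

variable [Finite P]

/-- The face operator `d_i` from `1`-chains to `0`-chains. -/
def chainModule.face (F : Sheaf.{u, v, w} R P) (i : Fin 2) : chainModule F 1 ⟶ chainModule F 0 :=
  chainModule.map F (SimplexCategory.δ (n := 0) i).toOrderHom

theorem chains_d_one_zero (F : Sheaf.{u, v, w} R P) :
    (chains F).d 1 0 = (chainModule.face F 0 - chainModule.face F 1 :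
      chainModule F 1 ⟶ chainModule F 0) := by
  refine (AlgebraicTopology.AlternatingFaceMapComplex.obj_d_eq _ 0).trans ?_
  rw [Fin.sum_univ_two, sub_eq_add_neg]
  congr 1
  · exact one_smul ℤ _
  · exact (congrArg (· • _) (pow_one (-1 : ℤ))).trans (neg_one_smul ℤ _)

/-- The inclusion of the summand `F(x)` of the `0`-chains. -/
def chainModule.pointι (F : Sheaf.{u, v, w} R P) (x : P) : F.obj (op x) ⟶ chainModule F 0 :=
  chainModule.ι F (Simplex.point x)

/-- The inclusion of the summand `F(y)` of the `1`-chains which belongs to `x ≤ y`. -/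
def chainModule.edgeι (F : Sheaf.{u, v, w} R P) {x y : P} (h : x ≤ y) :
    F.obj (op y) ⟶ chainModule F 1 :=
  chainModule.ι F (Simplex.edge h)

/-- The type of the summand depends on `σ`; keeping `σ` a variable lets the equality with a point be
substituted. -/
theorem str_ι_eq_str_pointι (F : Sheaf.{u, v, w} R P) {x y : P} (h : x ≤ y) {σ : Simplex P 0}
    (hσ : σ = Simplex.point x) (h' : σ.vertex 0 ≤ y) :
    F.str h' ≫ chainModule.ι F σ = F.str h ≫ chainModule.pointι F x := by
  subst hσ
  rfl

theorem edgeι_face_zero (F : Sheaf.{u, v, w} R P) {x y : P} (h : x ≤ y) :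
    chainModule.edgeι F h ≫ chainModule.face F 0 = F.str h ≫ chainModule.pointι F x :=
  (chainModule.ι_desc F _ _).trans (str_ι_eq_str_pointι F h (Simplex.eq_point _) _)

theorem edgeι_face_one (F : Sheaf.{u, v, w} R P) {x y : P} (h : x ≤ y) :
    chainModule.edgeι F h ≫ chainModule.face F 1 = chainModule.pointι F y := by
  refine (chainModule.ι_desc F _ _).trans ?_
  refine (str_ι_eq_str_pointι F (le_refl y) (Simplex.eq_point _) _).trans ?_
  rw [F.str_refl, Category.id_comp]

/-- The map from `0`-chains to the colimit. -/
def chainsToColimit (F : Sheaf.{u, v, w} R P) : chainModule F 0 ⟶ colimit F :=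
  chainModule.desc F fun σ => colimit.ι F (op (σ.vertex 0))

theorem pointι_chainsToColimit (F : Sheaf.{u, v, w} R P) (x : P) :
    chainModule.pointι F x ≫ chainsToColimit F = colimit.ι F (op x) :=
  chainModule.ι_desc F _ _

theorem map_comp_chainsToColimit (F : Sheaf.{u, v, w} R P) {n : ℕ}
    (g : Fin (0 + 1) →o Fin (n + 1)) :
    chainModule.map F g ≫ chainsToColimit F =
      chainModule.desc F fun σ => colimit.ι F (op (σ.vertex 0)) := by
  refine chainModule.hom_ext _ fun σ => ?_
  rw [chainModule.map, chainsToColimit, chainModule.ι_desc_assoc, Category.assoc,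
    chainModule.ι_desc, chainModule.ι_desc, Sheaf.str_colimit_ι]

theorem d_comp_chainsToColimit (F : Sheaf.{u, v, w} R P) :
    (chains F).d 1 0 ≫ (chainsToColimit F : (chains F).X 0 ⟶ _) = 0 := by
  have h : (chainModule.face F 0 - chainModule.face F 1) ≫ chainsToColimit F = 0 := by
    rw [Preadditive.sub_comp, chainModule.face, chainModule.face, map_comp_chainsToColimit,
      map_comp_chainsToColimit, sub_self]
  exact (congrArg (· ≫ chainsToColimit F) (chains_d_one_zero F)).trans h

instance (F : Sheaf.{u, v, w} R P) : Epi (chainsToColimit F) where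
  left_cancellation {M} φ ψ h := by
    refine colimit.hom_ext fun x => ?_
    have hx : chainModule.pointι F x.unop ≫ chainsToColimit F ≫ φ =
      chainModule.pointι F x.unop ≫ chainsToColimit F ≫ ψ := congrArg _ h
    rw [← Category.assoc, ← Category.assoc, pointι_chainsToColimit] at hx
    exact hx

/-- On the summand of an edge `x ≤ y`, vanishing on boundaries says that the component of `k` at `y`
is the structure map followed by the component at `x`, which is the cocone condition. -/
theorem exists_chainsToColimit_comp (F : Sheaf.{u, v, w} R P) {M : ModuleCat.{w} R}
    (k : chainModule F 0 ⟶ M) (hk : (chains F).d 1 0 ≫ (k : (chains F).X 0 ⟶ M) = 0) :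
    ∃ l, chainsToColimit F ≫ l = k := by
  have hk' : chainModule.face F 0 ≫ k = chainModule.face F 1 ≫ k := by
    rw [← sub_eq_zero, ← Preadditive.sub_comp]
    exact (congrArg (· ≫ k) (chains_d_one_zero F).symm).trans hk
  refine ⟨colimit.desc F
    { pt := M
      ι :=
        { app := fun x => chainModule.pointι F x.unop ≫ k
          naturality := fun y x g => ?_ } }, ?_⟩
  · have hg := leOfHom g.unop
    refine Eq.trans ?_ (Category.comp_id _).symm
    have h : chainModule.edgeι F hg ≫ chainModule.face F 0 ≫ k =
      chainModule.edgeι F hg ≫ chainModule.face F 1 ≫ k := congrArg _ hk'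
    rw [← Category.assoc, ← Category.assoc, edgeι_face_zero, edgeι_face_one,
      Category.assoc] at h
    exact h
  · refine chainModule.hom_ext F fun σ => ?_
    rw [chainsToColimit, chainModule.ι_desc_assoc]
    obtain ⟨x, rfl⟩ : ∃ x, σ = Simplex.point x := ⟨_, σ.eq_point⟩
    exact colimit.ι_desc _ _

/-- The colimit is the cokernel of the differential `S_1 ⟶ S_0`. -/
def isColimitChainsToColimit (F : Sheaf.{u, v, w} R P) :
    IsColimit (CokernelCofork.ofπ (f := (chains F).d 1 0)
      (chainsToColimit F : (chains F).X 0 ⟶ _) (d_comp_chainsToColimit F)) :=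
  CokernelCofork.IsColimit.ofπ _ _
    (fun k hk => (exists_chainsToColimit_comp F k hk).choose)
    (fun k hk => (exists_chainsToColimit_comp F k hk).choose_spec)
    (fun k hk _ hm => (cancel_epi (chainsToColimit F)).1
      (hm.trans (exists_chainsToColimit_comp F k hk).choose_spec.symm))

end ZerothHomology

/-! ### Reduced homology in degree `0` as the kernel of `ε_*` -/

section ReducedHomology

/-- If `p : K_1 ⟶ C` is a cokernel of `d : K_2 ⟶ K_1`, then `H_1(K)` is the kernel of the map
`C ⟶ K_0` induced by `d`. -/
theorem exists_homology_one_exact {R : Type v} [CommRing R]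
    (K : ChainComplex (ModuleCat.{w} R) ℕ) {C : ModuleCat.{w} R} {p : K.X 1 ⟶ C}
    (w : K.d 2 1 ≫ p = 0) (hp : IsColimit (CokernelCofork.ofπ p w)) {ε : C ⟶ K.X 0}
    (hε : p ≫ ε = K.d 1 0) : ∃ κ : K.homology 1 ⟶ C, Mono κ ∧ Function.Exact κ ε := by
  have h₁ := K.opcyclesIsCokernel 2 1 (by simp)
  let e : K.opcycles 1 ≅ C := h₁.coconePointUniqueUpToIso hp
  have he : K.pOpcycles 1 ≫ e.hom = p :=
    h₁.comp_coconePointUniqueUpToIso_hom hp WalkingParallelPair.one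
  have hε' : e.hom ≫ ε = K.fromOpcycles 1 0 := by
    rw [← cancel_epi (K.pOpcycles 1), ← Category.assoc, he, K.p_fromOpcycles, hε]
  have hz : (K.homologyι 1 ≫ e.hom) ≫ ε = 0 := by
    rw [Category.assoc, hε', K.homologyι_comp_fromOpcycles]
  refine ⟨K.homologyι 1 ≫ e.hom, mono_comp _ _, ?_⟩
  refine (ShortComplex.ShortExact.moduleCat_exact_iff_function_exact (ShortComplex.mk _ _ hz)).1 ?_
  refine ShortComplex.exact_of_iso (S₁ := .mk _ _ (K.homologyι_comp_fromOpcycles 1 0))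
    (ShortComplex.isoMk (Iso.refl _) e (Iso.refl _) (by simp) (by simp [hε'])) ?_
  exact ShortComplex.exact_of_f_is_kernel _ (K.homologyIsKernel 1 0 (by simp))

variable {R : Type v} [CommRing R] {P : Type u} [PartialOrder P] [OrderBot P] [Finite P]

theorem chainsToColimit_comp_epsilonStar (F : Sheaf.{u, v, w} R P) :
    chainsToColimit F.punctured ≫ epsilonStar F = augmentation F := by
  refine chainModule.hom_ext _ fun σ => ?_
  rw [chainsToColimit, augmentation, chainModule.ι_desc_assoc, chainModule.ι_desc]
  exact colimit.ι_desc _ _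

/-- The reduced homology in degree `0` is the kernel of `ε_*`. -/
theorem exists_reducedHomology_zero_exact (F : Sheaf.{u, v, w} R P) :
    ∃ κ : reducedHomology F 0 ⟶ colimit F.punctured,
      Mono κ ∧ Function.Exact κ (epsilonStar F) :=
  -- Augmentation shifts degrees by one: `H̃_0` is `H_1` of the augmented complex, and its
  -- differential from degree `2` to `1` is `S_1 ⟶ S_0`.
  exists_homology_one_exact (augmentedChains F) (d_comp_chainsToColimit F.punctured)
    (isColimitChainsToColimit F.punctured) (chainsToColimit_comp_epsilonStar F)

end ReducedHomology

/-! ### The partial adjoints for deletion and restriction -/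

section Lattice

variable {L : Type u} [Lattice L] [OrderBot L]

/-- The inclusion of `L_a ∖ 0` in `L ∖ 0`. -/
def puncturedDeletionIncl (a : L) : Punctured (Deletion a) →o Punctured L where
  toFun q := ⟨q.1.1, fun h => q.2 (Subtype.ext h)⟩
  monotone' _ _ h := h

/-- The inclusion of `L^a ∖ a` in `L ∖ 0`. -/
def puncturedRestrictionIncl {a : L} (ha : IsAtom a) : Punctured (Restriction a) →o Punctured L where
  toFun q := ⟨q.1.1, (ha.bot_lt.trans_le q.1.2).ne'⟩
  monotone' _ _ h := h

theorem lt_puncturedRestrictionIncl {a : L} (ha : IsAtom a) (q : Punctured (Restriction a)) :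
    a < (puncturedRestrictionIncl ha q).1 :=
  lt_of_le_of_ne q.1.2 fun h => q.2 (Subtype.ext h.symm)

/-- `L^a ∖ a` is an upper set of `L ∖ 0`. -/
def restrictionAdjoint {a : L} (ha : IsAtom a) :
    PartialRightAdjoint (puncturedRestrictionIncl ha) where
  dom x := a < x.1
  val x h := ⟨⟨x.1, h.le⟩, fun e => h.ne' (congrArg Subtype.val e)⟩
  le_iff q _ := ⟨fun h => ⟨(lt_puncturedRestrictionIncl ha q).trans_le h, h⟩, fun ⟨_, h⟩ => h⟩

theorem Deletion.ne_of_ne_bot {a : L} (ha : IsAtom a) (q : Deletion a) : q.1 ≠ a := by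
  intro h
  obtain ⟨s, hs, hq⟩ := q.2
  -- Every atom of `s` would lie below `a` and so equal `a`, which is excluded; hence `⊥` bounds `s`
  -- above and `a = ⊥`.
  refine ha.1 (h ▸ le_bot_iff.1 (hq.2 fun b hb => absurd ?_ (hs b hb).2))
  exact (ha.le_iff.1 (h ▸ hq.1 hb)).resolve_left (hs b hb).1.1

variable [Finite L]

open Classical in
/-- The largest element of the deletion `L_a` below `x`: the join of all atoms `≠ a` below `x`. -/
def Deletion.below (a x : L) : Deletion a :=
  have := Fintype.ofFinite L
  ⟨(Finset.univ.filter fun b => (IsAtom b ∧ b ≠ a) ∧ b ≤ x).sup id,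
    {b | (IsAtom b ∧ b ≠ a) ∧ b ≤ x}, fun _ hb => hb.1, by
      simpa using Finset.isLUB_sup_id (s := Finset.univ.filter fun b => (IsAtom b ∧ b ≠ a) ∧ b ≤ x)⟩

theorem Deletion.le_below_of_isAtom {a b x : L} (hb : IsAtom b) (hba : b ≠ a) (hbx : b ≤ x) :
    b ≤ (Deletion.below a x).1 :=
  Finset.le_sup (f := id) (by simp [hb, hba, hbx])

open Classical in
theorem Deletion.le_below_iff {a x : L} (q : Deletion a) : q ≤ Deletion.below a x ↔ q.1 ≤ x := by
  refine ⟨fun h => le_trans h (Finset.sup_le fun b hb => ?_), fun h => ?_⟩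
  · exact (Finset.mem_filter.1 hb).2.2
  · obtain ⟨s, hs, hq⟩ := q.2
    exact hq.2 fun b hb =>
      Deletion.le_below_of_isAtom (hs b hb).1 (hs b hb).2 ((hq.1 hb).trans h)

/-- Otherwise `a` is the only possible atom below `x`, and `x`, being a join of atoms, is `⊥` or
`a`. -/
theorem Deletion.below_ne_bot [IsAtomistic L] {a x : L} (hx : x ≠ ⊥) (hxa : x ≠ a) :
    Deletion.below a x ≠ ⊥ := by
  intro h
  have hb : ∀ b, IsAtom b → b ≤ x → b = a := fun b hb hbx => by
    by_contra hba
    have := Deletion.le_below_of_isAtom hb hba hbx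
    rw [h] at this
    exact hb.1 (le_bot_iff.1 this)
  obtain ⟨s, hs, hs'⟩ := IsAtomistic.isLUB_atoms x
  rcases s.eq_empty_or_nonempty with rfl | ⟨b, hbs⟩
  · exact hx (le_bot_iff.1 (hs.2 fun b hb => hb.elim))
  · have hab : b = a := hb b (hs' b hbs) (hs.1 hbs)
    refine hxa (le_antisymm (hs.2 fun c hc => (hb c (hs' c hc) (hs.1 hc)).le) ?_)
    exact hab ▸ hs.1 hbs

/-- The right adjoint of the inclusion `L_a ∖ 0 ⊆ L ∖ {0, a}`. -/
def deletionAdjoint [IsAtomistic L] {a : L} (ha : IsAtom a) :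
    PartialRightAdjoint (puncturedDeletionIncl a) where
  dom x := x ≠ ⟨a, ha.1⟩
  val x h := ⟨Deletion.below a x.1, Deletion.below_ne_bot x.2 fun e => h (Subtype.ext e)⟩
  le_iff q x := by
    refine ⟨fun h => ⟨?_, (Deletion.le_below_iff q.1).2 h⟩, fun ⟨_, h⟩ =>
      (Deletion.le_below_iff q.1).1 h⟩
    rintro rfl
    rcases ha.le_iff.1 h with e | e
    · exact q.2 (Subtype.ext e)
    · exact Deletion.ne_of_ne_bot ha q.1 e

end Lattice

end DeletionRestriction

end
open DeletionRestriction in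
/-- The deletion-restriction long exact sequence: `f`, `g`, `δ` are the maps
`H_i(L^a ∖ a; F) ⟶ H_i(L_a ∖ 0; F)` (for `i ≥ 1`), `H_i(L_a ∖ 0; F) ⟶ H_i(L ∖ 0; F)` (for `i ≥ 0`)
and `H_i(L ∖ 0; F) ⟶ H_{i-1}(L^a ∖ a; F)` (for `i ≥ 2`), and `δ₁`, `f₀`, `δ₀` are the remaining maps
to and from `H̃_0(L^a ∖ a; F)` and to `coker ε_*`. -/
theorem mainTheorem1 {R : Type v} [CommRing R] [Small.{w} R]
    {L : Type u} [Lattice L] [OrderBot L] [Finite L] [GradeOrder ℤ L] [IsAtomistic L]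
    (F : Sheaf.{u, v, w} R L) (a : L) (ha : IsAtom a) :
    ∃ (f : ∀ n : ℕ, homology (F.restriction a).punctured (n + 1) ⟶
          homology (F.deletion a).punctured (n + 1))
      (g : ∀ n : ℕ, homology (F.deletion a).punctured n ⟶ homology F.punctured n)
      (δ : ∀ n : ℕ, homology F.punctured (n + 2) ⟶
          homology (F.restriction a).punctured (n + 1))
      (δ₁ : homology F.punctured 1 ⟶ reducedHomology (F.restriction a) 0)
      (f₀ : reducedHomology (F.restriction a) 0 ⟶ homology (F.deletion a).punctured 0)
      (δ₀ : homology F.punctured 0 ⟶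
          CategoryTheory.Limits.cokernel (epsilonStar (F.restriction a))),
      (∀ n, Function.Exact (f n) (g (n + 1))) ∧
      (∀ n, Function.Exact (g (n + 2)) (δ n)) ∧
      (∀ n, Function.Exact (δ n) (f n)) ∧
      Function.Exact (g 1) δ₁ ∧
      Function.Exact δ₁ f₀ ∧
      Function.Exact f₀ (g 0) ∧
      Function.Exact (g 0) δ₀ ∧
      Function.Surjective δ₀ := by
  let a' : Punctured L := ⟨a, ha.1⟩
  have hmin : ∀ x : Punctured L, x ≤ a' → x = a' := fun x hx =>
    Subtype.ext ((ha.le_iff.1 hx).resolve_left x.2)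
  let j := puncturedRestrictionIncl ha
  let i := puncturedDeletionIncl a
  have hj : ∀ q, a' ≤ j q := fun q => (lt_puncturedRestrictionIncl ha q).le
  have hja : ∀ q, j q ≠ a' := fun q e =>
    (lt_puncturedRestrictionIncl ha q).ne' (congrArg Subtype.val e)
  have hj' : ∀ x, a' < x → ∃ q, j q = x := fun x hx => ⟨(restrictionAdjoint ha).val x hx, rfl⟩
  have hi : ∀ q, i q ≠ a' := fun q e => Deletion.ne_of_ne_bot ha q.1 (congrArg Subtype.val e)
  obtain ⟨κ, hκ, hκ'⟩ := exists_reducedHomology_zero_exact (F.restriction a)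
  -- Restricting to `L^a` and removing `a` agrees by definition with pulling `F.punctured` back
  -- along `j`; likewise `ε_*` is the map `colim j^* F ⟶ F(a)`.
  let κ' : reducedHomology (F.restriction a) 0 ⟶ (pullbackColim R j).obj F.punctured := κ
  have : Mono κ' := hκ
  let e₁ : ∀ n, _ ≅ homology (F.restriction a).punctured n :=
    (restrictionAdjoint ha).homologyIso F.punctured
  let e₂ : ∀ n, _ ≅ homology (F.deletion a).punctured n :=
    (deletionAdjoint ha).homologyIso F.punctured
  -- An identity, so that all three families are transported in the same way.
  let e₃ : ∀ n, ((colim : Sheaf.{u, v, w} R (Punctured L) ⥤ _).leftDerived n).obj F.punctured ≅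
    homology F.punctured n := fun n => Iso.refl _
  obtain ⟨f, g, δ, δ₁, f₀, δ₀, x₁, x₂, x₃, x₄, x₅, x₆, x₇, x₈⟩ :=
    exists_leftDerived_exact_of_common_cokernel (colimToEval R j hj) (cokerEvalπ R j hj)
      (colimToEval_comp_cokerEvalπ j hj) (colimPre R i) (colimToCokerEval R hmin j hj hj')
      (colimPre_comp_colimToCokerEval hmin j hj hj' i hi)
      (fun G _ => colimToEval_shortExact j hj (restrictionAdjoint ha) (fun _ h => h.le) G)
      (fun G _ => colimPre_shortExact hmin j hj hj' i (deletionAdjoint ha) (fun _ => Iff.rfl) hja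
        G _)
      F.punctured κ' hκ'
  let eN := Iso.refl (reducedHomology (F.restriction a) 0)
  let eC := Iso.refl (cokernel (epsilonStar (F.restriction a)))
  exact ⟨fun n => (e₁ (n + 1)).inv ≫ f n ≫ (e₂ (n + 1)).hom,
    fun n => (e₂ n).inv ≫ g n ≫ (e₃ n).hom,
    fun n => (e₃ (n + 2)).inv ≫ δ n ≫ (e₁ (n + 1)).hom,
    (e₃ 1).inv ≫ δ₁ ≫ eN.hom, eN.inv ≫ f₀ ≫ (e₂ 0).hom, (e₃ 0).inv ≫ δ₀ ≫ eC.hom,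
    fun n => exact_iso_comp (x₁ n) (e₁ (n + 1)).symm (e₂ (n + 1)) (e₃ (n + 1)),
    fun n => exact_iso_comp (x₂ n) (e₂ (n + 2)).symm (e₃ (n + 2)) (e₁ (n + 1)),
    fun n => exact_iso_comp (x₃ n) (e₃ (n + 2)).symm (e₁ (n + 1)) (e₂ (n + 1)),
    exact_iso_comp x₄ (e₂ 1).symm (e₃ 1) eN,
    exact_iso_comp x₅ (e₃ 1).symm eN (e₂ 0),
    exact_iso_comp x₆ eN.symm (e₂ 0) (e₃ 0),
    exact_iso_comp x₇ (e₂ 0).symm (e₃ 0) eC, x₈⟩
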